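/- **${\cal M}_c{\cal S}^{co}$-Coherence.** A *symmetric monoidal comonad* consists of a symmetric monoidal category $\langle{\cal A},\otimes,I,a,l,r,c\rangle$ with $a_{A,B,C}:(A\otimes B)\otimes C\to A\otimes(B\otimes C)$, $l_A:I\otimes A\to A$, $r_A:A\otimes I\to A$, $c_{A,B}:A\otimes B\to B\otimes A$, a comonad $\langle L,\varepsilon,\delta\rangle$ on ${\cal A}$, a natural transformation $\psi_{A,B}:LA\otimes LB\to L(A\otimes B)$ and an arrow $\psi_0:I\to LI$, such that $\langle L,\psi,\psi_0\rangle$ is a (lax) monoidal functor, $\varepsilon$ and $\delta$ are monoidal natural transformations, that is, $$\varepsilon_{A\otimes B}\circ\psi_{A,B}=\varepsilon_A\otimes\varepsilon_B,\qquad \delta_{A\otimes B}\circ\psi_{A,B}=L\psi_{A,B}\circ\psi_{LA,LB}\circ(\delta_A\otimes\delta_B),$$ $$\varepsilon_I\circ\psi_0=\mathbf 1_I,\qquad \delta_I\circ\psi_0=L\psi_0\circ\psi_0,$$ and $L$ is linear, that is, $Lc_{A,B}\circ\psi_{A,B}=\psi_{B,A}\circ c_{LA,LB}$. Let $X$ be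 an arbitrary set, and let ${\cal M}_c{\cal S}^{co}$ be the category of the symmetric monoidal comonad freely generated by $X$ as set of objects: its objects are the formulas built from the elements of $X$ (letters) and $I$ by means of $\otimes$ and $L$, and its arrows are the arrow terms built from $\mathbf 1$, $a$, $a^{-1}$, $l$, $l^{-1}$, $r$, $r^{-1}$, $c$, $\psi$, $\psi_0$, $\varepsilon$, $\delta$ by means of $\circ$, $\otimes$ and $L$, modulo the congruence generated by the equations of symmetric monoidal comonads. Let $Rel$ be the category whose objects are the finite ordinals and whose arrows are the relations between them. Let $GA$ be the number of occurrences of letters and of $L$ in $A$, these occurrences being numbered from right to left beginning with $0$, and define the relation $Gf\subseteq GA\times GB$ for an arrow term $f:A\to B$ inductively as follows. For $\mathbf 1$, $a^{\pm1}$, $l^{\pm1}$, $r^{\pm1}$ and $c$, it is the bijection that links each occurrence to the corresponding one. $G\psi_{A,B}$ links both outermost occurrences of $L$ in $LA\otimes LB$ to the outermost $L$ of $L(A\otimes B)$, and is the identity on the occurrences in $A$ and in $B$. $G\psi_0$ is the empty relation. $G\varepsilon_A$ links the outermost $L$ of $LA$ to nothing, $G\delta_A$ links it to both outermost occurrences of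 $L$ in $LLA$, and both are the identity on the occurrences in $A$. $G(f\otimes g)$ is the juxtaposition of $Gf$ and $Gg$; $GLf$ is $Gf$ with the new outermost occurrences of $L$ in the source and the target linked to each other; and $G(g\circ f)$ is the composite of the relations $Gf$ and $Gg$. Then $G$ is a functor from ${\cal M}_c{\cal S}^{co}$ to $Rel$, and it is faithful: if $f,g:A\to B$ are arrows of ${\cal M}_c{\cal S}^{co}$ with $Gf=Gg$, then $f=g$. -/

import Mathlib

open CategoryTheory MonoidalCategory

universe u

namespace MonoidalComonad

/-- The objects of the free symmetric monoidal comonad on a set `X` of generating objects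
(letters): the formulas built from letters and the unit `I` with `⊗` and the endofunctor `L`. -/
inductive Obj (X : Type u) : Type u
  | letter : X → Obj X
  | unit : Obj X
  | tensor : Obj X → Obj X → Obj X
  | box : Obj X → Obj X

variable {X : Type u}

/-- Arrow terms. `comp f g` is the composite "first `f`, then `g`". -/
inductive Term : Obj X → Obj X → Type u
  | id (A : Obj X) : Term A A
  | comp {A B C : Obj X} (f : Term A B) (g : Term B C) : Term A C
  | tensor {A B C D : Obj X} (f : Term A B) (g : Term C D) : Term (A.tensor C) (B.tensor D)
  | box {A B : Obj X} (f : Term A B) : Term A.box B.box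
  | a (A B C : Obj X) : Term ((A.tensor B).tensor C) (A.tensor (B.tensor C))
  | aInv (A B C : Obj X) : Term (A.tensor (B.tensor C)) ((A.tensor B).tensor C)
  | l (A : Obj X) : Term (Obj.unit.tensor A) A
  | lInv (A : Obj X) : Term A (Obj.unit.tensor A)
  | r (A : Obj X) : Term (A.tensor Obj.unit) A
  | rInv (A : Obj X) : Term A (A.tensor Obj.unit)
  | c (A B : Obj X) : Term (A.tensor B) (B.tensor A)
  | psi (A B : Obj X) : Term (A.box.tensor B.box) (A.tensor B).box
  | psi0 : Term Obj.unit Obj.unit.box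
  | eps (A : Obj X) : Term A.box A
  | delta (A : Obj X) : Term A.box A.box.box

/-- Equality of arrow terms in the free symmetric monoidal comonad: the congruence generated by
the defining equations of a symmetric monoidal comonad. -/
inductive TermEq : {A B : Obj X} → Term A B → Term A B → Prop
  -- congruence
  | refl {A B : Obj X} (f : Term A B) : TermEq f f
  | symm {A B : Obj X} {f g : Term A B} : TermEq f g → TermEq g f
  | trans {A B : Obj X} {f g h : Term A B} : TermEq f g → TermEq g h → TermEq f h
  | comp {A B C : Obj X} {f f' : Term A B} {g g' : Term B C} :
      TermEq f f' → TermEq g g' → TermEq (f.comp g) (f'.comp g')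
  | tensor {A B C D : Obj X} {f f' : Term A B} {g g' : Term C D} :
      TermEq f f' → TermEq g g' → TermEq (f.tensor g) (f'.tensor g')
  | box {A B : Obj X} {f f' : Term A B} : TermEq f f' → TermEq f.box f'.box
  -- category
  | id_comp {A B : Obj X} (f : Term A B) : TermEq ((Term.id A).comp f) f
  | comp_id {A B : Obj X} (f : Term A B) : TermEq (f.comp (Term.id B)) f
  | assoc {A B C D : Obj X} (f : Term A B) (g : Term B C) (h : Term C D) :
      TermEq ((f.comp g).comp h) (f.comp (g.comp h))
  -- the tensor is a bifunctor
  | tensor_id (A B : Obj X) : TermEq ((Term.id A).tensor (Term.id B)) (Term.id (A.tensor B))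
  | tensor_comp {A B C A' B' C' : Obj X} (f : Term A B) (g : Term B C) (f' : Term A' B')
      (g' : Term B' C') :
      TermEq ((f.comp g).tensor (f'.comp g')) ((f.tensor f').comp (g.tensor g'))
  -- symmetric monoidal structure
  | a_aInv (A B C : Obj X) : TermEq ((Term.a A B C).comp (Term.aInv A B C)) (Term.id _)
  | aInv_a (A B C : Obj X) : TermEq ((Term.aInv A B C).comp (Term.a A B C)) (Term.id _)
  | l_lInv (A : Obj X) : TermEq ((Term.l A).comp (Term.lInv A)) (Term.id _)
  | lInv_l (A : Obj X) : TermEq ((Term.lInv A).comp (Term.l A)) (Term.id _)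
  | r_rInv (A : Obj X) : TermEq ((Term.r A).comp (Term.rInv A)) (Term.id _)
  | rInv_r (A : Obj X) : TermEq ((Term.rInv A).comp (Term.r A)) (Term.id _)
  | a_nat {A B C A' B' C' : Obj X} (f : Term A A') (g : Term B B') (h : Term C C') :
      TermEq (((f.tensor g).tensor h).comp (Term.a A' B' C'))
        ((Term.a A B C).comp (f.tensor (g.tensor h)))
  | l_nat {A B : Obj X} (f : Term A B) :
      TermEq (((Term.id Obj.unit).tensor f).comp (Term.l B)) ((Term.l A).comp f)
  | r_nat {A B : Obj X} (f : Term A B) :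
      TermEq ((f.tensor (Term.id Obj.unit)).comp (Term.r B)) ((Term.r A).comp f)
  | c_nat {A B A' B' : Obj X} (f : Term A A') (g : Term B B') :
      TermEq ((f.tensor g).comp (Term.c A' B')) ((Term.c A B).comp (g.tensor f))
  | pentagon (A B C D : Obj X) :
      TermEq (((Term.a A B C).tensor (Term.id D)).comp
          ((Term.a A (B.tensor C) D).comp ((Term.id A).tensor (Term.a B C D))))
        ((Term.a (A.tensor B) C D).comp (Term.a A B (C.tensor D)))
  | triangle (A B : Obj X) :
      TermEq ((Term.a A Obj.unit B).comp ((Term.id A).tensor (Term.l B)))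
        ((Term.r A).tensor (Term.id B))
  | hexagon (A B C : Obj X) :
      TermEq ((Term.a A B C).comp ((Term.c A (B.tensor C)).comp (Term.a B C A)))
        (((Term.c A B).tensor (Term.id C)).comp
          ((Term.a B A C).comp ((Term.id B).tensor (Term.c A C))))
  | c_c (A B : Obj X) : TermEq ((Term.c A B).comp (Term.c B A)) (Term.id _)
  -- `L` is a functor
  | box_id (A : Obj X) : TermEq (Term.id A).box (Term.id A.box)
  | box_comp {A B C : Obj X} (f : Term A B) (g : Term B C) :
      TermEq (f.comp g).box (f.box.comp g.box)
  -- `L` with `ψ`, `ψ₀` is a monoidal functor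
  | psi_nat {A B A' B' : Obj X} (f : Term A A') (g : Term B B') :
      TermEq ((f.box.tensor g.box).comp (Term.psi A' B')) ((Term.psi A B).comp (f.tensor g).box)
  | psi_a (A B C : Obj X) :
      TermEq (((Term.psi A B).tensor (Term.id C.box)).comp
          ((Term.psi (A.tensor B) C).comp (Term.a A B C).box))
        ((Term.a A.box B.box C.box).comp
          (((Term.id A.box).tensor (Term.psi B C)).comp (Term.psi A (B.tensor C))))
  | psi_l (A : Obj X) :
      TermEq ((Term.psi0.tensor (Term.id A.box)).comp
          ((Term.psi Obj.unit A).comp (Term.l A).box))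
        (Term.l A.box)
  | psi_r (A : Obj X) :
      TermEq (((Term.id A.box).tensor Term.psi0).comp
          ((Term.psi A Obj.unit).comp (Term.r A).box))
        (Term.r A.box)
  -- `L` is linear: it preserves `c` up to `ψ`
  | psi_c (A B : Obj X) :
      TermEq ((Term.psi A B).comp (Term.c A B).box) ((Term.c A.box B.box).comp (Term.psi B A))
  -- `L` with `ε`, `δ` is a comonad
  | eps_nat {A B : Obj X} (f : Term A B) :
      TermEq (f.box.comp (Term.eps B)) ((Term.eps A).comp f)
  | delta_nat {A B : Obj X} (f : Term A B) :
      TermEq (f.box.comp (Term.delta B)) ((Term.delta A).comp f.box.box)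
  | delta_eps (A : Obj X) : TermEq ((Term.delta A).comp (Term.eps A.box)) (Term.id _)
  | delta_box_eps (A : Obj X) : TermEq ((Term.delta A).comp (Term.eps A).box) (Term.id _)
  | delta_delta (A : Obj X) :
      TermEq ((Term.delta A).comp (Term.delta A).box) ((Term.delta A).comp (Term.delta A.box))
  -- `ε` and `δ` are monoidal natural transformations
  | psi_eps (A B : Obj X) :
      TermEq ((Term.psi A B).comp (Term.eps (A.tensor B))) ((Term.eps A).tensor (Term.eps B))
  | psi_delta (A B : Obj X) :
      TermEq ((Term.psi A B).comp (Term.delta (A.tensor B)))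
        (((Term.delta A).tensor (Term.delta B)).comp
          ((Term.psi A.box B.box).comp (Term.psi A B).box))
  | psi0_eps : TermEq (Term.psi0.comp (Term.eps (Obj.unit : Obj X))) (Term.id _)
  | psi0_delta :
      TermEq (Term.psi0.comp (Term.delta (Obj.unit : Obj X))) (Term.psi0.comp Term.psi0.box)

instance termSetoid (A B : Obj X) : Setoid (Term A B) where
  r := TermEq
  iseqv := ⟨TermEq.refl, TermEq.symm, TermEq.trans⟩

/-- The category of the symmetric monoidal comonad freely generated by the set `X` of objects:
arrows are equivalence classes of arrow terms. -/
instance : Category.{u} (Obj X) where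
  Hom A B := Quotient (termSetoid A B)
  id A := ⟦Term.id A⟧
  comp := Quotient.map₂ Term.comp (fun _ _ hf _ _ hg => TermEq.comp hf hg)
  id_comp := by rintro _ _ ⟨f⟩; exact Quotient.sound (.id_comp f)
  comp_id := by rintro _ _ ⟨f⟩; exact Quotient.sound (.comp_id f)
  assoc := by rintro _ _ _ _ ⟨f⟩ ⟨g⟩ ⟨h⟩; exact Quotient.sound (.assoc f g h)

/-! The declarations up to the next heading record that this category carries the structure of a symmetric
monoidal comonad. -/

instance : MonoidalCategory (Obj X) :=
  letI : MonoidalCategoryStruct (Obj X) :=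
    { tensorObj := Obj.tensor
      tensorUnit := Obj.unit
      tensorHom := Quotient.map₂ Term.tensor (fun _ _ hf _ _ hg => TermEq.tensor hf hg)
      whiskerLeft := fun A _ _ =>
        Quotient.map (fun f => (Term.id A).tensor f) (fun _ _ h => .tensor (.refl _) h)
      whiskerRight := fun f A =>
        Quotient.map (fun f => f.tensor (Term.id A)) (fun _ _ h => .tensor h (.refl _)) f
      associator := fun A B C => ⟨⟦Term.a A B C⟧, ⟦Term.aInv A B C⟧,
        Quotient.sound (.a_aInv A B C), Quotient.sound (.aInv_a A B C)⟩
      leftUnitor := fun A => ⟨⟦Term.l A⟧, ⟦Term.lInv A⟧,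
        Quotient.sound (.l_lInv A), Quotient.sound (.lInv_l A)⟩
      rightUnitor := fun A => ⟨⟦Term.r A⟧, ⟦Term.rInv A⟧,
        Quotient.sound (.r_rInv A), Quotient.sound (.rInv_r A)⟩ }
  MonoidalCategory.ofTensorHom
    (id_tensorHom_id := fun A B => Quotient.sound (.tensor_id A B))
    (id_tensorHom := by rintro _ _ _ ⟨f⟩; rfl)
    (tensorHom_id := by rintro _ _ ⟨f⟩ _; rfl)
    (tensorHom_comp_tensorHom := by
      rintro _ _ _ _ _ _ ⟨f⟩ ⟨g⟩ ⟨h⟩ ⟨k⟩; exact Quotient.sound (.symm (.tensor_comp f h g k)))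
    (associator_naturality := by
      rintro _ _ _ _ _ _ ⟨f⟩ ⟨g⟩ ⟨h⟩; exact Quotient.sound (.a_nat f g h))
    (leftUnitor_naturality := by rintro _ _ ⟨f⟩; exact Quotient.sound (.l_nat f))
    (rightUnitor_naturality := by rintro _ _ ⟨f⟩; exact Quotient.sound (.r_nat f))
    (pentagon := fun A B C D => Quotient.sound (.pentagon A B C D))
    (triangle := fun A B => Quotient.sound (.triangle A B))

/-- The braiding given by the arrows `c`. -/
def braid (A B : Obj X) : A ⊗ B ≅ B ⊗ A :=
  ⟨⟦Term.c A B⟧, ⟦Term.c B A⟧, Quotient.sound (.c_c A B), Quotient.sound (.c_c B A)⟩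

theorem braid_hexagon (A B C : Obj X) :
    (α_ A B C).hom ≫ (braid A (B ⊗ C)).hom ≫ (α_ B C A).hom =
      ((braid A B).hom ▷ C) ≫ (α_ B A C).hom ≫ (B ◁ (braid A C).hom) :=
  Quotient.sound (.hexagon A B C)

instance : SymmetricCategory (Obj X) where
  braiding := braid
  braiding_naturality_right := by
    rintro _ _ _ ⟨f⟩; exact Quotient.sound (.c_nat (Term.id _) f)
  braiding_naturality_left := by
    rintro _ _ ⟨f⟩ _; exact Quotient.sound (.c_nat f (Term.id _))
  hexagon_forward := braid_hexagon
  hexagon_reverse := fun A B C => by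
    have h := congrArg (fun f => (α_ A B C).inv ≫ (braid (A ⊗ B) C).hom ≫ (α_ C A B).inv ≫ f ≫
      (A ◁ (braid B C).hom) ≫ (α_ A C B).inv ≫ ((braid A C).hom ▷ B)) (braid_hexagon C A B)
    have e (P Q : Obj X) : (braid P Q).hom ≫ (braid Q P).hom = 𝟙 _ := (braid P Q).hom_inv_id
    have e1 (P Q R : Obj X) : P ◁ (braid Q R).hom ≫ P ◁ (braid R Q).hom = 𝟙 _ := by
      rw [← whiskerLeft_comp, e, whiskerLeft_id]
    have e2 (P Q R : Obj X) : (braid Q R).hom ▷ P ≫ (braid R Q).hom ▷ P = 𝟙 _ := by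
      rw [← comp_whiskerRight, e, id_whiskerRight]
    simp only [Category.assoc, Iso.inv_hom_id_assoc, reassoc_of% e, reassoc_of% e1,
      Iso.hom_inv_id_assoc, e2, Category.comp_id] at h
    exact h.symm
  symmetry := fun A B => (braid A B).hom_inv_id

/-- The comonad `⟨L, ε, δ⟩`. -/
def comonad (X : Type u) : Comonad (Obj X) where
  obj := Obj.box
  map := Quotient.map Term.box (fun _ _ h => .box h)
  map_id A := Quotient.sound (.box_id A)
  map_comp := by rintro _ _ _ ⟨f⟩ ⟨g⟩; exact Quotient.sound (.box_comp f g)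
  ε := { app := fun A => ⟦Term.eps A⟧
         naturality := by rintro _ _ ⟨f⟩; exact Quotient.sound (.eps_nat f) }
  δ := { app := fun A => ⟦Term.delta A⟧
         naturality := by rintro _ _ ⟨f⟩; exact Quotient.sound (.delta_nat f) }
  coassoc A := Quotient.sound (.delta_delta A)
  left_counit A := Quotient.sound (.delta_eps A)
  right_counit A := Quotient.sound (.delta_box_eps A)

instance : (comonad X).toFunctor.LaxMonoidal :=
  Functor.LaxMonoidal.ofTensorHom
    (ε := ⟦Term.psi0⟧)
    (μ := fun A B => ⟦Term.psi A B⟧)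
    (μ_natural := by rintro _ _ _ _ ⟨f⟩ ⟨g⟩; exact Quotient.sound (.psi_nat f g))
    (associativity := fun A B C => Quotient.sound (.psi_a A B C))
    (left_unitality := fun A => Quotient.sound (.symm (.psi_l A)))
    (right_unitality := fun A => Quotient.sound (.symm (.psi_r A)))

instance : (comonad X).toFunctor.LaxBraided where
  braided A B := Quotient.sound (.psi_c A B)

instance : NatTrans.IsMonoidal (comonad X).ε where
  unit := Quotient.sound .psi0_eps
  tensor A B := Quotient.sound (.trans (.psi_eps A B) (.symm (.comp_id _)))

instance : NatTrans.IsMonoidal (comonad X).δ where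
  unit := Quotient.sound .psi0_delta
  tensor A B := Quotient.sound (.psi_delta A B)

/-! ### The functor `G` -/

/-- The occurrences of letters and of `L` in a formula; in `L A` the outermost `L` is `none`. -/
def Occ : Obj X → Type
  | .letter _ => Unit
  | .unit => Empty
  | .tensor A B => Occ A ⊕ Occ B
  | .box A => Option (Occ A)

/-- The number of occurrences of letters and of `L` in a formula. -/
def size : Obj X → ℕ
  | .letter _ => 1
  | .unit => 0
  | .tensor A B => size A + size B
  | .box A => size A + 1

/-- The occurrences numbered from right to left, starting with `0`. -/
def number : (A : Obj X) → Occ A ≃ Fin (size A)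
  | .letter _ => finOneEquiv.symm
  | .unit => finZeroEquiv.symm
  | .tensor A B => (Equiv.sumComm _ _).trans (((number B).sumCongr (number A)).trans
      (finSumFinEquiv.trans (finCongr (Nat.add_comm _ _))))
  | .box A => (number A).optionCongr.trans finSuccEquivLast.symm

/-- The bijection `(α ⊕ β) ⊕ γ → α ⊕ (β ⊕ γ)`. -/
@[simp] def reassoc {α β γ : Type} : (α ⊕ β) ⊕ γ → α ⊕ (β ⊕ γ)
  | .inl (.inl x) => .inl x
  | .inl (.inr x) => .inr (.inl x)
  | .inr x => .inr (.inr x)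

/-- The relation between the occurrences in the source and those in the target of an arrow
term. -/
def link : {A B : Obj X} → Term A B → Occ A → Occ B → Prop
  | _, _, .id _ => fun x y => x = y
  | _, _, .comp f g => fun x z => ∃ y, link f x y ∧ link g y z
  | _, _, .tensor f g => Sum.LiftRel (link f) (link g)
  | _, _, .box f => Option.Rel (link f)
  | _, _, .a _ _ _ => fun x y => reassoc x = y
  | _, _, .aInv _ _ _ => fun x y => x = reassoc y
  | _, _, .l _ => fun x y => x = Sum.inr y
  | _, _, .lInv _ => fun x y => Sum.inr x = y
  | _, _, .r _ => fun x y => x = Sum.inl y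
  | _, _, .rInv _ => fun x y => Sum.inl x = y
  | _, _, .c _ _ => fun x y => Sum.swap x = y
  -- both outermost `L`'s of the source are linked to the outermost `L` of the target
  | _, _, .psi _ _ => fun x y => Sum.elim (Option.map Sum.inl) (Option.map Sum.inr) x = y
  -- the empty relation
  | _, _, .psi0 => fun _ _ => False
  -- the outermost `L` of the source is linked to nothing
  | _, _, .eps _ => fun x y => x = some y
  -- the outermost `L` of the source is linked to the two outermost `L`'s of the target
  | _, _, .delta _ => fun x y => x = Option.join y

@[simp] theorem optionRel_none_none {α β : Type} {R : α → β → Prop} : Option.Rel R none none ↔ True :=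
  iff_true_intro .none

@[simp] theorem optionRel_none_some {α β : Type} {R : α → β → Prop} {y : β} :
    Option.Rel R none (some y) ↔ False := iff_false_intro nofun

@[simp] theorem optionRel_some_none {α β : Type} {R : α → β → Prop} {x : α} :
    Option.Rel R (some x) none ↔ False := iff_false_intro nofun

@[simp] theorem optionRel_some_some {α β : Type} {R : α → β → Prop} {x : α} {y : β} :
    Option.Rel R (some x) (some y) ↔ R x y := ⟨fun | .some h => h, .some⟩

/-- Equal arrow terms induce the same relation. -/
theorem link_eq {A B : Obj X} {f g : Term A B} (h : TermEq f g) : link f = link g := by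
  induction h with
  | refl => rfl
  | symm _ h => exact h.symm
  | trans _ _ h h' => exact h.trans h'
  | comp _ _ h h' => simp only [link, h, h']
  | tensor _ _ h h' => simp only [link, h, h']; rfl
  | box _ h => simp only [link, h]; rfl
  | id_comp f =>
    dsimp only [link, Occ]; ext x y
    simp
  | comp_id f =>
    dsimp only [link, Occ]; ext x y
    simp
  | assoc f g h =>
    dsimp only [link, Occ]; ext x y; grind
  | tensor_id A B =>
    dsimp only [link, Occ]; ext x y; rcases x with x | x <;> rcases y with y | y <;>
      simp
  | tensor_comp f g f' g' =>
    dsimp only [link, Occ]; ext x y; rcases x with x | x <;> rcases y with y | y <;>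
      simp
  | a_aInv A B C =>
    dsimp only [link, Occ]; ext x y; rcases x with (x | x) | x <;> rcases y with (y | y) | y <;>
    simp
  | aInv_a A B C =>
    dsimp only [link, Occ]; ext x y; rcases x with x | x | x <;> rcases y with y | y | y <;>
    simp
  | l_lInv A =>
    dsimp only [link, Occ]; ext x y; rcases x with x | x <;> rcases y with y | y <;>
      first | exact Empty.elim x | exact Empty.elim y | simp
  | lInv_l A =>
    dsimp only [link, Occ]; ext x y
    simp
  | r_rInv A =>
    dsimp only [link, Occ]; ext x y; rcases x with x | x <;> rcases y with y | y <;>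
      first | exact Empty.elim x | exact Empty.elim y | simp
  | rInv_r A =>
    dsimp only [link, Occ]; ext x y
    simp
  | a_nat f g h =>
    dsimp only [link, Occ]; ext x y; rcases x with (x | x) | x <;> rcases y with y | y | y <;>
      simp
  | l_nat f =>
    dsimp only [link, Occ]; ext x y; rcases x with x | x <;>
      simp
  | r_nat f =>
    dsimp only [link, Occ]; ext x y; rcases x with x | x <;>
      simp
  | c_nat f g =>
    dsimp only [link, Occ]; ext x y; rcases x with x | x <;> rcases y with y | y <;>
      simp
  | pentagon A B C D =>
    dsimp only [link, Occ]; ext x y; rcases x with ((x | x) | x) | x <;> rcases y with y | y | y | y <;>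
      simp
  | triangle A B =>
    dsimp only [link, Occ]; ext x y; rcases x with (x | x) | x <;> rcases y with y | y <;>
      simp
  | hexagon A B C =>
    dsimp only [link, Occ]; ext x y; rcases x with (x | x) | x <;> rcases y with y | y | y <;>
      simp
  | c_c A B =>
    dsimp only [link, Occ]; ext x y
    simp
  | box_id A =>
    dsimp only [link, Occ]; ext x y; rcases x with _ | x <;> rcases y with _ | y <;>
      simp
  | box_comp f g =>
    dsimp only [link, Occ]; ext x y; rcases x with _ | x <;> rcases y with _ | y <;>
      simp [Option.exists]
  | psi_nat f g =>
    dsimp only [link, Occ]; ext x y; rcases x with (_ | x) | (_ | x) <;> rcases y with _ | y | y <;>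
      simp
  | psi_a A B C =>
    dsimp only [link, Occ]; ext x y; rcases x with ((_ | x) | (_ | x)) | (_ | x) <;> rcases y with _ | y | y | y <;>
      simp
  | psi_l A =>
    dsimp only [link, Occ]; ext x y; rcases x with x | (_ | x) <;> rcases y with _ | y <;>
      simp
  | psi_r A =>
    dsimp only [link, Occ]; ext x y; rcases x with (_ | x) | x <;> rcases y with _ | y <;>
      simp
  | psi_c A B =>
    dsimp only [link, Occ]; ext x y; rcases x with (_ | x) | (_ | x) <;> rcases y with _ | y | y <;>
      simp
  | eps_nat f =>
    dsimp only [link, Occ]; ext x y; rcases x with _ | x <;>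
      simp
  | delta_nat f =>
    dsimp only [link, Occ]; ext x y; rcases x with _ | x <;> rcases y with _ | _ | y <;>
      simp [Option.exists]
  | delta_eps A =>
    dsimp only [link, Occ]; ext x y; rcases x with _ | x <;> rcases y with _ | y <;>
      simp
  | delta_box_eps A =>
    dsimp only [link, Occ]; ext x y; rcases x with _ | x <;> rcases y with _ | y <;>
      simp [Option.exists]
  | delta_delta A =>
    dsimp only [link, Occ]; ext x y; rcases x with _ | x <;> rcases y with _ | _ | _ | y <;>
      simp [Option.exists]
  | psi_eps A B =>
    dsimp only [link, Occ]; ext x y; rcases x with (_ | x) | (_ | x) <;> rcases y with y | y <;>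
      simp
  | psi_delta A B =>
    dsimp only [link, Occ]; ext x y; rcases x with (_ | x) | (_ | x) <;> rcases y with _ | _ | y | y <;>
      simp [Option.exists]
  | psi0_eps =>
    dsimp only [link, Occ]; ext x y; rcases x
  | psi0_delta =>
    dsimp only [link, Occ]; ext x y; rcases x

/-- The objects of the skeletal category of relations between finite sets: the finite ordinals,
each given by its number of elements. -/
structure FinRel where
  card : ℕ

/-- The arrows of this category are the relations between finite ordinals. -/
instance : Category FinRel where
  Hom m n := SetRel (Fin m.card) (Fin n.card)
  id _ := SetRel.id
  comp R S := R.comp S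
  id_comp R := R.id_comp
  comp_id R := R.comp_id
  assoc R S T := R.comp_assoc S T

/-- The relation between `Fin (size A)` and `Fin (size B)` induced by an arrow term. -/
def graph {A B : Obj X} (f : Term A B) : SetRel (Fin (size A)) (Fin (size B)) :=
  {p | link f ((number A).symm p.1) ((number B).symm p.2)}

/-- The functor `G` from the free symmetric monoidal comonad to `Rel`. -/
def G (X : Type u) : Obj X ⥤ FinRel where
  obj A := ⟨size A⟩
  map f := Quotient.lift graph (fun _ _ h => by unfold graph; rw [link_eq h]) f
  map_id A := Set.ext fun _ => (number A).symm.injective.eq_iff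
  map_comp {_ B _} := by
    rintro ⟨f⟩ ⟨g⟩
    exact Set.ext fun _ => (number B).symm.surjective.exists

end MonoidalComonad

/-! Faithfulness is proved by induction on the target formula, for all sources at once and without
normal forms: an arrow `f : A ⟶ B` is cut into arrows with smaller targets, and the links tell where
to cut.

A selection `T` in `B` opens some outermost `L`'s and divides what is then visible into a taken and
a left part, so it yields an arrow `T.split` from `B` to their tensor product. By `pullsBack`, every
`f` carries `T` back to a selection `S` in `A` with `f ≫ T.split = S.split ≫ (f₁ ⊗ₘ f₂)`. The links
of `f` determine the marked occurrences of `S`, hence `S`; since `S.split` can be cancelled on the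
level of links (`Separating.homLink_cancel`), they also determine the links of `f₁` and `f₂`. So two
arrows with equal links are cut along the same `S`, into components with equal links.

For target `B₁ ⊗ B₂`, take all of `B₁` and leave all of `B₂`. Then `T.split` is invertible and the
components have targets isomorphic to `B₁` and `B₂`. For target `L B`, take the whole box. The
component into `L B` is then a homomorphism of coalgebras into a cofree one, so it is determined by
its composite with `ε`, whose target is `B`. For targets `I` and a letter there is at most one arrow
from each source, because precomposition with any arrow preserves the canonical arrows `IsErasure`
and `IsPoint`. -/

/-! ### Identities for interchange and unitors. -/

/-- In a symmetric monoidal category the middle-four interchange commutes with the symmetry. -/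
theorem CategoryTheory.SymmetricCategory.braiding_tensorμ {C : Type*} [Category C]
    [MonoidalCategory C] [SymmetricCategory C] (A₁ A₂ B₁ B₂ : C) :
    (β_ (A₁ ⊗ A₂) (B₁ ⊗ B₂)).hom ≫ tensorμ B₁ B₂ A₁ A₂ =
      tensorμ A₁ A₂ B₁ B₂ ≫ ((β_ A₁ B₁).hom ⊗ₘ (β_ A₂ B₂).hom) := by
  -- The braiding of the tensor products consists of four crossings. The crossing of `A₁` with `B₂`
  -- meets its reverse in `tensorμ B₁ B₂ A₁ A₂`, and symmetry cancels the pair.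
  have h (P Q : C) : P ◁ (β_ A₁ B₂).hom ▷ Q ≫ P ◁ (β_ B₂ A₁).hom ▷ Q = 𝟙 _ := by
    rw [← whiskerLeft_comp, ← comp_whiskerRight, SymmetricCategory.symmetry]; simp
  have e : (β_ (A₁ ⊗ A₂) (B₁ ⊗ B₂)).hom =
      𝟙 _ ⊗≫ A₁ ◁ (β_ A₂ B₁).hom ▷ B₂ ⊗≫ (β_ A₁ B₁).hom ▷ (A₂ ⊗ B₂) ⊗≫
        (B₁ ⊗ A₁) ◁ (β_ A₂ B₂).hom ⊗≫ B₁ ◁ (β_ A₁ B₂).hom ▷ A₂ ⊗≫ 𝟙 _ := by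
    simp only [BraidedCategory.braiding_tensor_left_hom, BraidedCategory.braiding_tensor_right_hom]
    simp only [whiskerLeft_comp, comp_whiskerRight, Category.assoc]
    monoidal
  calc _ = 𝟙 _ ⊗≫ A₁ ◁ (β_ A₂ B₁).hom ▷ B₂ ⊗≫ (β_ A₁ B₁).hom ▷ (A₂ ⊗ B₂) ⊗≫
        (B₁ ⊗ A₁) ◁ (β_ A₂ B₂).hom ⊗≫
          (B₁ ◁ (β_ A₁ B₂).hom ▷ A₂ ≫ B₁ ◁ (β_ B₂ A₁).hom ▷ A₂) ⊗≫ 𝟙 _ := by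
        rw [e, tensorμ]; monoidal
    _ = _ := by rw [h, tensorμ, MonoidalCategory.tensorHom_def]; monoidal

section monoidal

variable {C : Type*} [Category C] [MonoidalCategory C]

theorem CategoryTheory.MonoidalCategory.comp_leftUnitor_inv {A B : C} (f : A ⟶ B) :
    f ≫ (λ_ B).inv = (λ_ A).inv ≫ (𝟙 (𝟙_ C) ⊗ₘ f) := by simp

theorem CategoryTheory.MonoidalCategory.comp_rightUnitor_inv {A B : C} (f : A ⟶ B) :
    f ≫ (ρ_ B).inv = (ρ_ A).inv ≫ (f ⊗ₘ 𝟙 (𝟙_ C)) := by simp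

theorem CategoryTheory.MonoidalCategory.eq_comp_id_tensorHom_id {A P Q : C} {f g : A ⟶ P ⊗ Q}
    (h : f = g) : f = g ≫ (𝟙 P ⊗ₘ 𝟙 Q) := by simp [h]

/-- Turns the splitting square of a structural isomorphism into the square of its inverse. -/
theorem CategoryTheory.MonoidalCategory.inv_comp_eq_comp_tensorHom_inv {A B P Q P' Q' : C}
    {i : A ≅ B} {j : P ≅ P'} {k : Q ≅ Q'} {s : A ⟶ P ⊗ Q} {t : B ⟶ P' ⊗ Q'}
    (h : i.hom ≫ t = s ≫ (j.hom ⊗ₘ k.hom)) : i.inv ≫ s = t ≫ (j.inv ⊗ₘ k.inv) := by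
  rw [Iso.inv_comp_eq, ← Category.assoc, h, Category.assoc, tensorHom_comp_tensorHom]
  simp

/-- The splitting square of `ψ` when the target box is left whole: both source boxes are left, and
the two empty taken parts merge into one unit. -/
theorem CategoryTheory.MonoidalCategory.comp_leftUnitor_inv_tensorμ [BraidedCategory C]
    {A B D : C} (f : A ⊗ B ⟶ D) : f ≫ (λ_ D).inv =
      (((λ_ A).inv ⊗ₘ (λ_ B).inv) ≫ tensorμ _ _ _ _) ≫ ((λ_ (𝟙_ C)).hom ⊗ₘ f) := by
  have h := leftUnitor_monoidal A B
  rw [← cancel_mono (λ_ D).hom, Category.assoc, Iso.inv_hom_id, Category.comp_id]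
  calc
    _ = ((λ_ A).inv ⊗ₘ (λ_ B).inv) ≫ ((λ_ A).hom ⊗ₘ (λ_ B).hom) ≫ f := by
      rw [tensorHom_comp_tensorHom_assoc]; simp
    _ = _ := by
      rw [h, MonoidalCategory.tensorHom_def (λ_ (𝟙_ C)).hom f]; simp

theorem CategoryTheory.MonoidalCategory.comp_rightUnitor_inv_tensorμ [BraidedCategory C]
    {A B D : C} (f : A ⊗ B ⟶ D) : f ≫ (ρ_ D).inv =
      (((ρ_ A).inv ⊗ₘ (ρ_ B).inv) ≫ tensorμ _ _ _ _) ≫ (f ⊗ₘ (λ_ (𝟙_ C)).hom) := by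
  have h := rightUnitor_monoidal A B
  rw [← cancel_mono (ρ_ D).hom, Category.assoc, Iso.inv_hom_id, Category.comp_id]
  calc
    _ = ((ρ_ A).inv ⊗ₘ (ρ_ B).inv) ≫ ((ρ_ A).hom ⊗ₘ (ρ_ B).hom) ≫ f := by
      rw [tensorHom_comp_tensorHom_assoc]; simp
    _ = _ := by
      rw [h, MonoidalCategory.tensorHom_def' f (λ_ (𝟙_ C)).hom]; simp

end monoidal

/-! ### Named arrows and equations of the free category. -/

namespace MonoidalComonad

variable {X : Type u}

/-- The action of the comonad `L` on arrows. -/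
def boxMap {A B : Obj X} (f : A ⟶ B) : A.box ⟶ B.box := (comonad X).map f

/-- The arrow `ψ`. -/
def psi (A B : Obj X) : A.box ⊗ B.box ⟶ (A ⊗ B).box := ⟦Term.psi A B⟧
/-- The arrow `ψ₀`. -/
def psi0 : 𝟙_ (Obj X) ⟶ (𝟙_ (Obj X)).box := ⟦Term.psi0⟧
/-- The counit `ε`. -/
def eps (A : Obj X) : A.box ⟶ A := ⟦Term.eps A⟧
/-- The comultiplication `δ`. -/
def delta (A : Obj X) : A.box ⟶ A.box.box := ⟦Term.delta A⟧

/-- Induction on arrows of the free symmetric monoidal comonad. -/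
theorem hom_induction {P : ∀ {A B : Obj X}, (A ⟶ B) → Prop}
    (id : ∀ A : Obj X, P (𝟙 A))
    (comp : ∀ {A B C : Obj X} (f : A ⟶ B) (g : B ⟶ C), P f → P g → P (f ≫ g))
    (tensor : ∀ {A B C D : Obj X} (f : A ⟶ B) (g : C ⟶ D), P f → P g → P (f ⊗ₘ g))
    (box : ∀ {A B : Obj X} (f : A ⟶ B), P f → P (boxMap f))
    (a : ∀ A B C : Obj X, P (α_ A B C).hom) (aInv : ∀ A B C : Obj X, P (α_ A B C).inv)
    (l : ∀ A : Obj X, P (λ_ A).hom) (lInv : ∀ A : Obj X, P (λ_ A).inv)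
    (r : ∀ A : Obj X, P (ρ_ A).hom) (rInv : ∀ A : Obj X, P (ρ_ A).inv)
    (c : ∀ A B : Obj X, P (β_ A B).hom)
    (psi : ∀ A B : Obj X, P (psi A B)) (psi0 : P (psi0 (X := X)))
    (eps : ∀ A : Obj X, P (eps A)) (delta : ∀ A : Obj X, P (delta A))
    {A B : Obj X} (f : A ⟶ B) : P f := by
  induction f using Quotient.ind with | _ f
  induction f with
  | id A => exact id A
  | comp f g hf hg => exact comp _ _ hf hg
  | tensor f g hf hg => exact tensor _ _ hf hg
  | box f hf => exact box _ hf
  | a A B C => exact a A B C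
  | aInv A B C => exact aInv A B C
  | l A => exact l A
  | lInv A => exact lInv A
  | r A => exact r A
  | rInv A => exact rInv A
  | c A B => exact c A B
  | psi A B => exact psi A B
  | psi0 => exact psi0
  | eps A => exact eps A
  | delta A => exact delta A

section equations

variable {A B C D : Obj X}

theorem boxMap_id (A : Obj X) : boxMap (𝟙 A) = 𝟙 A.box := (comonad X).map_id A

theorem boxMap_comp (f : A ⟶ B) (g : B ⟶ C) : boxMap (f ≫ g) = boxMap f ≫ boxMap g :=
  (comonad X).map_comp f g

theorem psi_natural (f : A ⟶ B) (g : C ⟶ D) :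
    (boxMap f ⊗ₘ boxMap g) ≫ psi B D = psi A C ≫ boxMap (f ⊗ₘ g) := by
  induction f using Quotient.ind
  induction g using Quotient.ind
  exact Quotient.sound (.psi_nat _ _)

theorem psi_associativity (A B C : Obj X) :
    (psi A B ⊗ₘ 𝟙 C.box) ≫ psi (A ⊗ B) C ≫ boxMap (α_ A B C).hom =
      (α_ A.box B.box C.box).hom ≫ (𝟙 A.box ⊗ₘ psi B C) ≫ psi A (B ⊗ C) :=
  Quotient.sound (.psi_a A B C)

theorem psi_left_unitality (A : Obj X) :
    (psi0 ⊗ₘ 𝟙 A.box) ≫ psi (𝟙_ _) A ≫ boxMap (λ_ A).hom = (λ_ A.box).hom :=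
  Quotient.sound (.psi_l A)

theorem psi_right_unitality (A : Obj X) :
    (𝟙 A.box ⊗ₘ psi0) ≫ psi A (𝟙_ _) ≫ boxMap (ρ_ A).hom = (ρ_ A.box).hom :=
  Quotient.sound (.psi_r A)

theorem psi_braiding (A B : Obj X) :
    psi A B ≫ boxMap (β_ A B).hom = (β_ A.box B.box).hom ≫ psi B A :=
  Quotient.sound (.psi_c A B)

theorem eps_natural (f : A ⟶ B) : boxMap f ≫ eps B = eps A ≫ f :=
  (comonad X).ε.naturality f

theorem eps_natural_assoc (f : A ⟶ B) (h : B ⟶ C) : boxMap f ≫ eps B ≫ h = eps A ≫ f ≫ h := by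
  rw [← Category.assoc, eps_natural, Category.assoc]

theorem delta_natural (f : A ⟶ B) : boxMap f ≫ delta B = delta A ≫ boxMap (boxMap f) :=
  (comonad X).δ.naturality f

theorem delta_eps (A : Obj X) : delta A ≫ eps A.box = 𝟙 _ := (comonad X).left_counit A

theorem delta_eps_assoc (A : Obj X) (h : A.box ⟶ B) : delta A ≫ eps A.box ≫ h = h := by
  rw [← Category.assoc, delta_eps, Category.id_comp]

theorem delta_boxMap_eps (A : Obj X) : delta A ≫ boxMap (eps A) = 𝟙 _ :=
  (comonad X).right_counit A

theorem delta_delta (A : Obj X) : delta A ≫ boxMap (delta A) = delta A ≫ delta A.box :=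
  (comonad X).coassoc A

theorem psi_eps (A B : Obj X) : psi A B ≫ eps (A ⊗ B) = eps A ⊗ₘ eps B :=
  Quotient.sound (.psi_eps A B)

theorem psi_eps_assoc (A B : Obj X) (h : A ⊗ B ⟶ C) :
    psi A B ≫ eps (A ⊗ B) ≫ h = (eps A ⊗ₘ eps B) ≫ h := by
  rw [← Category.assoc, psi_eps]

theorem psi_delta (A B : Obj X) :
    psi A B ≫ delta (A ⊗ B) = (delta A ⊗ₘ delta B) ≫ psi A.box B.box ≫ boxMap (psi A B) :=
  Quotient.sound (.psi_delta A B)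

theorem psi0_eps : psi0 ≫ eps (𝟙_ (Obj X)) = 𝟙 _ := Quotient.sound .psi0_eps

theorem psi0_eps_assoc (h : 𝟙_ (Obj X) ⟶ A) : psi0 ≫ eps (𝟙_ (Obj X)) ≫ h = h := by
  rw [← Category.assoc, psi0_eps, Category.id_comp]

theorem psi0_delta : psi0 ≫ delta (𝟙_ (Obj X)) = psi0 ≫ boxMap psi0 :=
  Quotient.sound .psi0_delta

end equations

/-! ### Links of arrows. -/

/-- The relation between occurrences induced by an arrow. -/
def homLink {A B : Obj X} (f : A ⟶ B) : Occ A → Occ B → Prop :=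
  Quotient.lift link (fun _ _ h => link_eq h) f

theorem homLink_comp {A B C : Obj X} (f : A ⟶ B) (g : B ⟶ C) (x : Occ A) (z : Occ C) :
    homLink (f ≫ g) x z ↔ ∃ y, homLink f x y ∧ homLink g y z := by
  induction f using Quotient.ind
  induction g using Quotient.ind
  rfl

theorem homLink_tensor {A B C D : Obj X} (f : A ⟶ B) (g : C ⟶ D) :
    homLink (f ⊗ₘ g) = Sum.LiftRel (homLink f) (homLink g) := by
  induction f using Quotient.ind
  induction g using Quotient.ind
  rfl

theorem homLink_boxMap {A B : Obj X} (f : A ⟶ B) :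
    homLink (boxMap f) = Option.Rel (homLink f) := by
  induction f using Quotient.ind
  rfl

theorem homLink_comp_congr {A B C : Obj X} {f f' : A ⟶ B} {g g' : B ⟶ C}
    (hf : homLink f = homLink f') (hg : homLink g = homLink g') :
    homLink (f ≫ g) = homLink (f' ≫ g') := by
  ext x z
  rw [homLink_comp, homLink_comp, hf, hg]

/-! ### Selections and their splittings. -/

/-- A selection in a formula: some outermost occurrences of `L` are opened, and every letter and
every unopened outermost `L`-subformula that is then visible is either taken or left. -/
inductive Sel : Obj X → Type u
  | letter (x : X) (b : Bool) : Sel (.letter x)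
  | unit : Sel .unit
  | tensor {A B : Obj X} (S : Sel A) (T : Sel B) : Sel (A.tensor B)
  | whole (A : Obj X) (b : Bool) : Sel A.box
  | opened {A : Obj X} (S : Sel A) : Sel A.box

namespace Sel

/-- What a selection takes. -/
def taken : {A : Obj X} → Sel A → Obj X
  | _, letter x true => .letter x
  | _, letter _ false => 𝟙_ (Obj X)
  | _, unit => 𝟙_ (Obj X)
  | _, tensor S T => S.taken ⊗ T.taken
  | _, whole A true => A.box
  | _, whole _ false => 𝟙_ (Obj X)
  | _, opened S => S.taken

/-- What a selection leaves. -/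
def left : {A : Obj X} → Sel A → Obj X
  | _, letter x false => .letter x
  | _, letter _ true => 𝟙_ (Obj X)
  | _, unit => 𝟙_ (Obj X)
  | _, tensor S T => S.left ⊗ T.left
  | _, whole A false => A.box
  | _, whole _ true => 𝟙_ (Obj X)
  | _, opened S => S.left

/-- The arrow that separates what is taken from what is left. -/
def split : {A : Obj X} → (S : Sel A) → (A ⟶ S.taken ⊗ S.left)
  | _, letter x true => (ρ_ (Obj.letter x)).inv
  | _, letter x false => (λ_ (Obj.letter x)).inv
  | _, unit => (λ_ (𝟙_ (Obj X))).inv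
  | _, tensor S T => (S.split ⊗ₘ T.split) ≫ tensorμ S.taken S.left T.taken T.left
  | _, whole A true => (ρ_ A.box).inv
  | _, whole A false => (λ_ A.box).inv
  | _, @opened _ A S => eps A ≫ S.split

/-- The visible occurrences that are taken (`b = true`) or left (`b = false`). -/
def Marked (b : Bool) : {A : Obj X} → Sel A → Occ A → Prop
  | _, letter _ c => fun _ => c = b
  | _, unit => fun _ => False
  | _, tensor S T => Sum.elim (S.Marked b) (T.Marked b)
  | _, whole _ c => fun o => Option.elim o (c = b) fun _ => False
  | _, opened S => fun o => Option.elim o False (S.Marked b)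

/-- The marks show which boxes are opened: the outermost `L` of an unopened box always carries one
of the two marks, that of an opened box carries neither. -/
theorem eq_of_marked {A : Obj X} (S T : Sel A)
    (h : ∀ b o, S.Marked b o ↔ T.Marked b o) : S = T := by
  induction S with
  | letter x b =>
    cases T with | letter _ c
    have := h b ()
    simp_all [Marked]
  | unit => cases T; rfl
  | tensor S S' hS hS' =>
    cases T with | tensor T T'
    rw [hS T fun b o => h b (.inl o), hS' T' fun b o => h b (.inr o)]
  | whole A b =>
    cases T with
    | whole _ c =>
      have := h b none
      simp_all [Marked]
    | opened T =>
      have := h b none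
      simp_all [Marked]
  | opened S hS =>
    cases T with
    | whole _ c =>
      have := h c none
      simp_all [Marked]
    | opened T => rw [hS T fun b o => h b (some o)]

/-- The selection that opens nothing and takes everything (`b = true`) or leaves everything
(`b = false`). -/
def full (b : Bool) : (A : Obj X) → Sel A
  | .letter x => letter x b
  | .unit => unit
  | .tensor A B => tensor (full b A) (full b B)
  | .box A => whole A b

/-- Nothing is opened, so no `ε` occurs: the splitting only inserts units and interchanges factors.
-/
instance isIso_split_full (b : Bool) (A : Obj X) : IsIso (full b A).split := by
  induction A with
  | letter x =>
    cases b
    · exact inferInstanceAs (IsIso (λ_ (Obj.letter x)).inv)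
    · exact inferInstanceAs (IsIso (ρ_ (Obj.letter x)).inv)
  | unit => exact inferInstanceAs (IsIso (λ_ (𝟙_ (Obj X))).inv)
  | tensor A B hA hB =>
    have : IsIso (tensorμ (full b A).taken (full b A).left (full b B).taken (full b B).left) :=
      ⟨_, tensorμ_tensorδ _ _ _ _, tensorδ_tensorμ _ _ _ _⟩
    exact inferInstanceAs (IsIso (((full b A).split ⊗ₘ (full b B).split) ≫ tensorμ _ _ _ _))
  | box A =>
    cases b
    · exact inferInstanceAs (IsIso (λ_ A.box).inv)
    · exact inferInstanceAs (IsIso (ρ_ A.box).inv)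

theorem taken_full_true (A : Obj X) : (full true A).taken = A := by
  induction A with
  | tensor A B hA hB => exact congrArg₂ Obj.tensor hA hB
  | _ => rfl

theorem left_full_false (A : Obj X) : (full false A).left = A := by
  induction A with
  | tensor A B hA hB => exact congrArg₂ Obj.tensor hA hB
  | _ => rfl

theorem taken_full_false (A : Obj X) : Nonempty ((full false A).taken ≅ 𝟙_ (Obj X)) := by
  induction A with
  | tensor A B hA hB =>
    obtain ⟨i⟩ := hA
    obtain ⟨j⟩ := hB
    exact ⟨(i ⊗ᵢ j) ≪≫ λ_ _⟩
  | _ => exact ⟨Iso.refl _⟩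

theorem left_full_true (A : Obj X) : Nonempty ((full true A).left ≅ 𝟙_ (Obj X)) := by
  induction A with
  | tensor A B hA hB =>
    obtain ⟨i⟩ := hA
    obtain ⟨j⟩ := hB
    exact ⟨(i ⊗ᵢ j) ≪≫ λ_ _⟩
  | _ => exact ⟨Iso.refl _⟩

end Sel

/-! ### Cancelling splittings on the level of links. -/

/-- Every occurrence in the target is linked to an occurrence in the source that is linked to
nothing else. -/
def Separating {A B : Obj X} (f : A ⟶ B) : Prop :=
  ∀ y, ∃ x, ∀ y', homLink f x y' ↔ y' = y

namespace Separating

variable {A B C D : Obj X}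

theorem id (A : Obj X) : Separating (𝟙 A) := fun y => ⟨y, fun _ => eq_comm⟩

theorem comp {f : A ⟶ B} {g : B ⟶ C} (hf : Separating f) (hg : Separating g) :
    Separating (f ≫ g) := fun z => by
  obtain ⟨y, hy⟩ := hg z
  obtain ⟨x, hx⟩ := hf y
  exact ⟨x, fun z' => by simp [homLink_comp, hx, hy]⟩

theorem tensor {f : A ⟶ B} {g : C ⟶ D} (hf : Separating f) (hg : Separating g) :
    Separating (f ⊗ₘ g) := by
  rintro (y | y)
  · obtain ⟨x, hx⟩ := hf y
    refine ⟨.inl x, ?_⟩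
    rw [homLink_tensor]
    rintro (y' | y')
    · exact Sum.liftRel_inl_inl.trans ((hx y').trans Sum.inl_injective.eq_iff.symm)
    · exact iff_of_false nofun nofun
  · obtain ⟨x, hx⟩ := hg y
    refine ⟨.inr x, ?_⟩
    rw [homLink_tensor]
    rintro (y' | y')
    · exact iff_of_false nofun nofun
    · exact Sum.liftRel_inr_inr.trans ((hx y').trans Sum.inr_injective.eq_iff.symm)

theorem associator_hom (A B C : Obj X) : Separating (α_ A B C).hom := by
  rintro (y | y | y)
  · exact ⟨.inl (.inl y), fun _ => eq_comm⟩
  · exact ⟨.inl (.inr y), fun _ => eq_comm⟩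
  · exact ⟨.inr y, fun _ => eq_comm⟩

theorem associator_inv (A B C : Obj X) : Separating (α_ A B C).inv := by
  have inj : Function.Injective (reassoc (α := Occ A) (β := Occ B) (γ := Occ C)) := by
    rintro ((x | x) | x) ((y | y) | y) h <;> simp_all
  exact fun y => ⟨reassoc y, fun y' => eq_comm.trans inj.eq_iff⟩

theorem leftUnitor_inv (A : Obj X) : Separating (λ_ A).inv := by
  rintro (y | y)
  · exact y.elim
  · exact ⟨y, fun _ => eq_comm⟩

theorem rightUnitor_inv (A : Obj X) : Separating (ρ_ A).inv := by
  rintro (y | y)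
  · exact ⟨y, fun _ => eq_comm⟩
  · exact y.elim

theorem braiding (A B : Obj X) : Separating (β_ A B).hom := by
  rintro (y | y)
  · exact ⟨.inr y, fun _ => eq_comm⟩
  · exact ⟨.inl y, fun _ => eq_comm⟩

theorem eps (A : Obj X) : Separating (eps A) :=
  fun y => ⟨some y, fun _ => eq_comm.trans Option.some_inj⟩

theorem tensorμ (A B C D : Obj X) : Separating (tensorμ A B C D) := by
  rw [MonoidalCategory.tensorμ]
  simp only [← id_tensorHom, ← tensorHom_id]
  exact (associator_hom _ _ _).comp <| ((id _).tensor (associator_inv _ _ _)).comp <|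
    ((id _).tensor ((braiding _ _).tensor (id _))).comp <|
    ((id _).tensor (associator_hom _ _ _)).comp (associator_inv _ _ _)

/-- Splittings avoid the generators that break the property: `δ`, which links one `L` to two, and
`ψ₀`, whose target `L` is linked to nothing. -/
theorem split {A : Obj X} (S : Sel A) : Separating S.split := by
  induction S with
  | letter x b =>
    cases b
    · exact leftUnitor_inv _
    · exact rightUnitor_inv _
  | unit => exact leftUnitor_inv _
  | tensor S T hS hT => exact (hS.tensor hT).comp (tensorμ _ _ _ _)
  | whole A b =>
    cases b
    · exact leftUnitor_inv _
    · exact rightUnitor_inv _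
  | opened S hS => exact (eps _).comp hS

/-- The source occurrence linked to `y` alone has, after composition with `g`, exactly the links of
`y` under `g`. -/
theorem homLink_cancel {f : A ⟶ B} (hf : Separating f) {g h : B ⟶ C}
    (e : homLink (f ≫ g) = homLink (f ≫ h)) : homLink g = homLink h := by
  ext y z
  obtain ⟨x, hx⟩ := hf y
  have := congrFun (congrFun e x) z
  simpa [homLink_comp, hx] using this

end Separating

theorem homLink_tensor_inj {A B C D : Obj X} {f f' : A ⟶ B} {g g' : C ⟶ D}
    (e : homLink (f ⊗ₘ g) = homLink (f' ⊗ₘ g')) :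
    homLink f = homLink f' ∧ homLink g = homLink g' := by
  simp only [homLink_tensor] at e
  constructor
  · ext x y
    simpa using congrFun (congrFun e (.inl x)) (.inl y)
  · ext x y
    simpa using congrFun (congrFun e (.inr x)) (.inr y)

/-! ### Canonical coalgebras and their homomorphisms. -/

/-- The canonical `L`-coalgebra structure on a formula built from `L`-formulas with `⊗` and `I`. -/
def IsCoalg : (D : Obj X) → (D ⟶ D.box) → Prop
  | .letter _, _ => False
  | .unit, d => d = psi0
  | .tensor A B, d => ∃ d₁ d₂, IsCoalg A d₁ ∧ IsCoalg B d₂ ∧ d = (d₁ ⊗ₘ d₂) ≫ psi A B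
  | .box A, d => d = delta A

theorem IsCoalg.unique {D : Obj X} {d d' : D ⟶ D.box} (h : IsCoalg D d) (h' : IsCoalg D d') :
    d = d' := by
  induction D with
  | letter x => exact h.elim
  | unit => exact h.trans h'.symm
  | tensor A B hA hB =>
    obtain ⟨d₁, d₂, h₁, h₂, rfl⟩ := h
    obtain ⟨d₁', d₂', h₁', h₂', rfl⟩ := h'
    rw [hA h₁ h₁', hB h₂ h₂']
  | box A => exact h.trans h'.symm

theorem IsCoalg.tensor {D E : Obj X} {d : D ⟶ D.box} {e : E ⟶ E.box}
    (hd : IsCoalg D d) (he : IsCoalg E e) : IsCoalg (D ⊗ E) ((d ⊗ₘ e) ≫ psi D E) :=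
  ⟨d, e, hd, he, rfl⟩

theorem IsCoalg.exists_of_tensor {D E : Obj X} {d : D ⊗ E ⟶ (D ⊗ E).box}
    (h : IsCoalg (D ⊗ E) d) :
    ∃ d₁ d₂, IsCoalg D d₁ ∧ IsCoalg E d₂ ∧ d = (d₁ ⊗ₘ d₂) ≫ psi D E := h

theorem isCoalg_unit : IsCoalg (𝟙_ (Obj X)) psi0 := rfl

theorem isCoalg_box_iff {A : Obj X} {d : A.box ⟶ A.box.box} : IsCoalg A.box d ↔ d = delta A :=
  Iff.rfl

/-- The arrow is a homomorphism into the canonical coalgebra on the target, if there is one. -/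
def IsCoalgHom {D E : Obj X} (f : D ⟶ E) : Prop :=
  ∀ d, IsCoalg E d → ∃ d', IsCoalg D d' ∧ f ≫ d = d' ≫ boxMap f

namespace IsCoalgHom

variable {A B C D : Obj X}

theorem id (A : Obj X) : IsCoalgHom (𝟙 A) := fun d hd => ⟨d, hd, by simp [boxMap_id]⟩

theorem comp {f : A ⟶ B} {g : B ⟶ C} (hf : IsCoalgHom f) (hg : IsCoalgHom g) :
    IsCoalgHom (f ≫ g) := fun d hd => by
  obtain ⟨e, he, h⟩ := hg d hd
  obtain ⟨e', he', h'⟩ := hf e he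
  exact ⟨e', he', by rw [Category.assoc, h, reassoc_of% h', boxMap_comp]⟩

theorem tensor {f : A ⟶ B} {g : C ⟶ D} (hf : IsCoalgHom f) (hg : IsCoalgHom g) :
    IsCoalgHom (f ⊗ₘ g) := fun d hd => by
  obtain ⟨d₁, d₂, h₁, h₂, rfl⟩ := hd.exists_of_tensor
  obtain ⟨e₁, he₁, h₁'⟩ := hf d₁ h₁
  obtain ⟨e₂, he₂, h₂'⟩ := hg d₂ h₂
  refine ⟨_, he₁.tensor he₂, ?_⟩
  rw [tensorHom_comp_tensorHom_assoc, h₁', h₂', Category.assoc, ← psi_natural,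
    tensorHom_comp_tensorHom_assoc]

/-- The inverse of a homomorphism is a homomorphism once both ends carry structures; uniqueness
identifies the structure that `hi` yields on `A` with the given one. -/
theorem of_inv (i : A ≅ B) (h : ∀ d, IsCoalg A d → ∃ e, IsCoalg B e)
    (hi : IsCoalgHom i.hom) : IsCoalgHom i.inv := fun d hd => by
  obtain ⟨e, he⟩ := h d hd
  obtain ⟨d', hd', h'⟩ := hi e he
  obtain rfl := hd.unique hd'
  refine ⟨e, he, ?_⟩
  rw [Iso.inv_comp_eq, reassoc_of% h', ← boxMap_comp, Iso.hom_inv_id, boxMap_id, Category.comp_id]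

theorem associator_hom (A B C : Obj X) : IsCoalgHom (α_ A B C).hom := fun d hd => by
  obtain ⟨d₁, d₂, h₁, h₂, rfl⟩ := hd.exists_of_tensor
  obtain ⟨d₃, d₄, h₃, h₄, rfl⟩ := h₂.exists_of_tensor
  refine ⟨_, (h₁.tensor h₃).tensor h₄, ?_⟩
  have := psi_associativity A B C
  calc
    _ = (α_ A B C).hom ≫ (d₁ ⊗ₘ d₃ ⊗ₘ d₄) ≫ (𝟙 _ ⊗ₘ psi B C) ≫ psi _ _ := by
      rw [tensorHom_comp_tensorHom_assoc, Category.comp_id]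
    _ = ((d₁ ⊗ₘ d₃) ⊗ₘ d₄) ≫ (psi A B ⊗ₘ 𝟙 C.box) ≫ psi (A ⊗ B) C ≫ boxMap (α_ A B C).hom := by
      rw [this, associator_naturality_assoc]
    _ = _ := by rw [tensorHom_comp_tensorHom_assoc, Category.comp_id, Category.assoc]

theorem associator_inv (A B C : Obj X) : IsCoalgHom (α_ A B C).inv :=
  of_inv (α_ A B C) (fun d hd => by
    obtain ⟨d₁, d₂, h₁, h₂, rfl⟩ := hd.exists_of_tensor
    obtain ⟨d₃, d₄, h₃, h₄, rfl⟩ := h₁.exists_of_tensor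
    exact ⟨_, h₃.tensor (h₄.tensor h₂)⟩) (associator_hom A B C)

theorem leftUnitor_hom (A : Obj X) : IsCoalgHom (λ_ A).hom := fun d hd => by
  refine ⟨_, isCoalg_unit.tensor hd, ?_⟩
  have h := psi_left_unitality A
  calc _ = (𝟙 _ ⊗ₘ d) ≫ (λ_ A.box).hom := by rw [id_tensorHom, leftUnitor_naturality]
    _ = _ := by
      rw [← h, tensorHom_comp_tensorHom_assoc, Category.id_comp, Category.comp_id, Category.assoc]

theorem leftUnitor_inv (A : Obj X) : IsCoalgHom (λ_ A).inv :=
  of_inv (λ_ A) (fun d hd => by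
    obtain ⟨_, d₂, _, h₂, rfl⟩ := hd.exists_of_tensor
    exact ⟨_, h₂⟩) (leftUnitor_hom A)

theorem rightUnitor_hom (A : Obj X) : IsCoalgHom (ρ_ A).hom := fun d hd => by
  refine ⟨_, hd.tensor isCoalg_unit, ?_⟩
  have h := psi_right_unitality A
  calc _ = (d ⊗ₘ 𝟙 _) ≫ (ρ_ A.box).hom := by rw [tensorHom_id, rightUnitor_naturality]
    _ = _ := by
      rw [← h, tensorHom_comp_tensorHom_assoc, Category.id_comp, Category.comp_id, Category.assoc]

theorem rightUnitor_inv (A : Obj X) : IsCoalgHom (ρ_ A).inv :=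
  of_inv (ρ_ A) (fun d hd => by
    obtain ⟨d₁, _, h₁, _, rfl⟩ := hd.exists_of_tensor
    exact ⟨_, h₁⟩) (rightUnitor_hom A)

theorem braiding (A B : Obj X) : IsCoalgHom (β_ A B).hom := fun d hd => by
  obtain ⟨d₁, d₂, h₁, h₂, rfl⟩ := hd.exists_of_tensor
  refine ⟨_, h₂.tensor h₁, ?_⟩
  rw [Category.assoc, psi_braiding, BraidedCategory.braiding_naturality_assoc]

theorem boxMap (f : A ⟶ B) : IsCoalgHom (boxMap f) := fun d hd => by
  obtain rfl := isCoalg_box_iff.1 hd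
  exact ⟨delta A, rfl, delta_natural f⟩

theorem delta (A : Obj X) : IsCoalgHom (delta A) := fun d hd => by
  obtain rfl := isCoalg_box_iff.1 hd
  exact ⟨MonoidalComonad.delta A, rfl, (delta_delta A).symm⟩

theorem psi (A B : Obj X) : IsCoalgHom (psi A B) := fun d hd => by
  obtain rfl := isCoalg_box_iff.1 hd
  exact ⟨_, IsCoalg.tensor (D := A.box) (E := B.box) rfl rfl, by rw [psi_delta, Category.assoc]⟩

theorem psi0 : IsCoalgHom (psi0 (X := X)) := fun d hd => by
  obtain rfl := isCoalg_box_iff.1 hd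
  exact ⟨_, isCoalg_unit, psi0_delta⟩

/-- A homomorphism into a cofree coalgebra is determined by its composite with `ε`. -/
theorem ext {f g : A ⟶ B.box} (hf : IsCoalgHom f) (hg : IsCoalgHom g)
    (h : f ≫ eps B = g ≫ eps B) : f = g := by
  obtain ⟨d, hd, hd'⟩ := hf (MonoidalComonad.delta B) rfl
  obtain ⟨e, he, he'⟩ := hg (MonoidalComonad.delta B) rfl
  obtain rfl := hd.unique he
  rw [← Category.comp_id f, ← Category.comp_id g, ← delta_boxMap_eps, reassoc_of% hd',
    reassoc_of% he', ← boxMap_comp, ← boxMap_comp, h]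

end IsCoalgHom

/-! ### Canonical arrows into the unit and into a letter. -/

/-- The canonical arrow that opens every `L` in a formula without letters. -/
def IsErasure : (A : Obj X) → (A ⟶ 𝟙_ (Obj X)) → Prop
  | .letter _, _ => False
  | .unit, u => u = 𝟙 _
  | .tensor A B, u => ∃ v w, IsErasure A v ∧ IsErasure B w ∧ u = (v ⊗ₘ w) ≫ (λ_ _).hom
  | .box A, u => ∃ v, IsErasure A v ∧ u = eps A ≫ v

namespace IsErasure

theorem unique {A : Obj X} {u v : A ⟶ 𝟙_ (Obj X)} (hu : IsErasure A u) (hv : IsErasure A v) :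
    u = v := by
  induction A with
  | letter x => exact hu.elim
  | unit => exact hu.trans hv.symm
  | tensor A B hA hB =>
    obtain ⟨u₁, u₂, h₁, h₂, rfl⟩ := hu
    obtain ⟨v₁, v₂, h₁', h₂', rfl⟩ := hv
    rw [hA h₁ h₁', hB h₂ h₂']
  | box A hA =>
    obtain ⟨u, hu, rfl⟩ := hu
    obtain ⟨v, hv, rfl⟩ := hv
    rw [hA hu hv]

theorem tensor {A B : Obj X} {u : A ⟶ 𝟙_ (Obj X)} {v : B ⟶ 𝟙_ (Obj X)}
    (hu : IsErasure A u) (hv : IsErasure B v) : IsErasure (A ⊗ B) ((u ⊗ₘ v) ≫ (λ_ _).hom) :=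
  ⟨u, v, hu, hv, rfl⟩

theorem exists_of_tensor {A B : Obj X} {u : A ⊗ B ⟶ 𝟙_ (Obj X)} (h : IsErasure (A ⊗ B) u) :
    ∃ v w, IsErasure A v ∧ IsErasure B w ∧ u = (v ⊗ₘ w) ≫ (λ_ _).hom := h

theorem unit : IsErasure (𝟙_ (Obj X)) (𝟙 _) := rfl

theorem unit_iff {u : 𝟙_ (Obj X) ⟶ 𝟙_ (Obj X)} : IsErasure (𝟙_ (Obj X)) u ↔ u = 𝟙 _ := Iff.rfl

theorem eps_comp {A : Obj X} {u : A ⟶ 𝟙_ (Obj X)} (h : IsErasure A u) :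
    IsErasure A.box (eps A ≫ u) := ⟨u, h, rfl⟩

/-- With `u` the identity of `I`, this makes every arrow into `I` canonical, hence unique. The
generators reduce to coherence, naturality of `ε`, monoidality of `ε`, and the counit law. -/
theorem comp {A B : Obj X} (f : A ⟶ B) {u : B ⟶ 𝟙_ (Obj X)} (hu : IsErasure B u) :
    IsErasure A (f ≫ u) := by
  induction f using hom_induction with
  | id A => rwa [Category.id_comp]
  | comp f g hf hg => rw [Category.assoc]; exact hf (hg hu)
  | tensor f g hf hg =>
    obtain ⟨v, w, hv, hw, rfl⟩ := hu.exists_of_tensor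
    rw [tensorHom_comp_tensorHom_assoc]
    exact (hf hv).tensor (hg hw)
  | box f hf =>
    obtain ⟨v, hv, rfl⟩ := hu
    rw [eps_natural_assoc]
    exact (hf hv).eps_comp
  | a A B C =>
    obtain ⟨v₁, w, h₁, hw, rfl⟩ := hu.exists_of_tensor
    obtain ⟨v₂, v₃, h₂, h₃, rfl⟩ := hw.exists_of_tensor
    convert (h₁.tensor h₂).tensor h₃ using 1
    monoidal
  | aInv A B C =>
    obtain ⟨w, v₃, hw, h₃, rfl⟩ := hu.exists_of_tensor
    obtain ⟨v₁, v₂, h₁, h₂, rfl⟩ := hw.exists_of_tensor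
    convert h₁.tensor (h₂.tensor h₃) using 1
    monoidal
  | l A =>
    convert unit.tensor hu using 1
    simp
  | lInv A =>
    obtain ⟨v, w, hv, hw, rfl⟩ := hu.exists_of_tensor
    obtain rfl := unit_iff.1 hv
    simpa using hw
  | r A =>
    convert hu.tensor unit using 1
    simp [unitors_equal]
  | rInv A =>
    obtain ⟨v, w, hv, hw, rfl⟩ := hu.exists_of_tensor
    obtain rfl := unit_iff.1 hw
    simpa [unitors_equal] using hv
  | c A B =>
    obtain ⟨v, w, hv, hw, rfl⟩ := hu.exists_of_tensor
    convert hw.tensor hv using 1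
    rw [← BraidedCategory.braiding_naturality_assoc, braiding_leftUnitor, unitors_equal]
  | psi A B =>
    obtain ⟨v, hv, rfl⟩ := hu
    obtain ⟨v₁, v₂, h₁, h₂, rfl⟩ := hv.exists_of_tensor
    rw [psi_eps_assoc, tensorHom_comp_tensorHom_assoc]
    exact h₁.eps_comp.tensor h₂.eps_comp
  | psi0 =>
    obtain ⟨v, hv, rfl⟩ := hu
    rw [psi0_eps_assoc]
    exact hv
  | eps A => exact hu.eps_comp
  | delta A =>
    obtain ⟨v, hv, rfl⟩ := hu
    rw [delta_eps_assoc]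
    exact hv

end IsErasure

/-- The canonical arrow that opens every `L` in a formula whose only letter is `x`. -/
def IsPoint (x : X) : (A : Obj X) → (A ⟶ Obj.letter x) → Prop
  | .letter y, u => ∃ h : y = x, u = eqToHom (congrArg Obj.letter h)
  | .unit, _ => False
  | .tensor A B, u =>
    (∃ v w, IsPoint x A v ∧ IsErasure B w ∧ u = (v ⊗ₘ w) ≫ (ρ_ (Obj.letter x)).hom) ∨
      ∃ v w, IsErasure A v ∧ IsPoint x B w ∧ u = (v ⊗ₘ w) ≫ (λ_ (Obj.letter x)).hom
  | .box A, u => ∃ v, IsPoint x A v ∧ u = eps A ≫ v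

namespace IsPoint

variable {x : X}

/-- One formula cannot both contain a letter and contain none. For a tensor product this settles
which factor holds the letter, as uniqueness requires. -/
theorem not_isErasure {A : Obj X} {u : A ⟶ Obj.letter x} {v : A ⟶ 𝟙_ (Obj X)}
    (hu : IsPoint x A u) (hv : IsErasure A v) : False := by
  induction A with
  | letter x => exact hv
  | unit => exact hu
  | tensor A B hA hB =>
    obtain ⟨v₁, v₂, h₁, h₂, rfl⟩ := hv
    rcases hu with ⟨u₁, u₂, h₁', h₂', rfl⟩ | ⟨u₁, u₂, h₁', h₂', rfl⟩
    · exact hA h₁' h₁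
    · exact hB h₂' h₂
  | box A hA =>
    obtain ⟨u, hu, rfl⟩ := hu
    obtain ⟨v, hv, rfl⟩ := hv
    exact hA hu hv

theorem unique {A : Obj X} {u v : A ⟶ Obj.letter x} (hu : IsPoint x A u) (hv : IsPoint x A v) :
    u = v := by
  induction A with
  | letter x =>
    obtain ⟨rfl, rfl⟩ := hu
    obtain ⟨_, rfl⟩ := hv
    rfl
  | unit => exact hu.elim
  | tensor A B hA hB =>
    rcases hu with ⟨u₁, u₂, h₁, h₂, rfl⟩ | ⟨u₁, u₂, h₁, h₂, rfl⟩ <;>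
      rcases hv with ⟨v₁, v₂, h₁', h₂', rfl⟩ | ⟨v₁, v₂, h₁', h₂', rfl⟩
    · rw [hA h₁ h₁', h₂.unique h₂']
    · exact (not_isErasure h₁ h₁').elim
    · exact (not_isErasure h₁' h₁).elim
    · rw [h₁.unique h₁', hB h₂ h₂']
  | box A hA =>
    obtain ⟨u, hu, rfl⟩ := hu
    obtain ⟨v, hv, rfl⟩ := hv
    rw [hA hu hv]

theorem tensor_left {A B : Obj X} {u : A ⟶ Obj.letter x} {v : B ⟶ 𝟙_ (Obj X)}
    (hu : IsPoint x A u) (hv : IsErasure B v) : IsPoint x (A ⊗ B) ((u ⊗ₘ v) ≫ (ρ_ _).hom) :=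
  .inl ⟨u, v, hu, hv, rfl⟩

theorem tensor_right {A B : Obj X} {u : A ⟶ 𝟙_ (Obj X)} {v : B ⟶ Obj.letter x}
    (hu : IsErasure A u) (hv : IsPoint x B v) : IsPoint x (A ⊗ B) ((u ⊗ₘ v) ≫ (λ_ _).hom) :=
  .inr ⟨u, v, hu, hv, rfl⟩

theorem cases_tensor {A B : Obj X} {u : A ⊗ B ⟶ Obj.letter x} (h : IsPoint x (A ⊗ B) u) :
    (∃ v w, IsPoint x A v ∧ IsErasure B w ∧ u = (v ⊗ₘ w) ≫ (ρ_ (Obj.letter x)).hom) ∨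
      ∃ v w, IsErasure A v ∧ IsPoint x B w ∧ u = (v ⊗ₘ w) ≫ (λ_ (Obj.letter x)).hom := h

theorem eps_comp {A : Obj X} {u : A ⟶ Obj.letter x} (h : IsPoint x A u) :
    IsPoint x A.box (eps A ≫ u) := ⟨u, h, rfl⟩

theorem comp {A B : Obj X} (f : A ⟶ B) {u : B ⟶ Obj.letter x} (hu : IsPoint x B u) :
    IsPoint x A (f ≫ u) := by
  induction f using hom_induction with
  | id A => rwa [Category.id_comp]
  | comp f g hf hg => rw [Category.assoc]; exact hf (hg hu)
  | tensor f g hf hg =>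
    rcases hu.cases_tensor with ⟨v, w, hv, hw, rfl⟩ | ⟨v, w, hv, hw, rfl⟩
    · rw [tensorHom_comp_tensorHom_assoc]
      exact (hf hv).tensor_left (hw.comp g)
    · rw [tensorHom_comp_tensorHom_assoc]
      exact tensor_right (hv.comp f) (hg hw)
  | box f hf =>
    obtain ⟨v, hv, rfl⟩ := hu
    rw [eps_natural_assoc]
    exact (hf hv).eps_comp
  | a A B C =>
    rcases hu.cases_tensor with ⟨v₁, w, h₁, hw, rfl⟩ | ⟨v₁, w, h₁, hw, rfl⟩
    · obtain ⟨v₂, v₃, h₂, h₃, rfl⟩ := hw.exists_of_tensor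
      convert (h₁.tensor_left h₂).tensor_left h₃ using 1
      monoidal
    · rcases hw.cases_tensor with ⟨v₂, v₃, h₂, h₃, rfl⟩ | ⟨v₂, v₃, h₂, h₃, rfl⟩
      · convert (tensor_right h₁ h₂).tensor_left h₃ using 1
        monoidal
      · convert tensor_right (h₁.tensor h₂) h₃ using 1
        monoidal
  | aInv A B C =>
    rcases hu.cases_tensor with ⟨w, v₃, hw, h₃, rfl⟩ | ⟨w, v₃, hw, h₃, rfl⟩
    · rcases hw.cases_tensor with ⟨v₁, v₂, h₁, h₂, rfl⟩ | ⟨v₁, v₂, h₁, h₂, rfl⟩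
      · convert h₁.tensor_left (h₂.tensor h₃) using 1
        monoidal
      · convert tensor_right h₁ (h₂.tensor_left h₃) using 1
        monoidal
    · obtain ⟨v₁, v₂, h₁, h₂, rfl⟩ := hw.exists_of_tensor
      convert tensor_right h₁ (tensor_right h₂ h₃) using 1
      monoidal
  | l A =>
    convert tensor_right .unit hu using 1
    simp
  | lInv A =>
    rcases hu.cases_tensor with ⟨v, w, hv, hw, rfl⟩ | ⟨v, w, hv, hw, rfl⟩
    · exact hv.elim
    · obtain rfl := IsErasure.unit_iff.1 hv
      simpa using hw
  | r A =>
    convert hu.tensor_left .unit using 1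
    simp
  | rInv A =>
    rcases hu.cases_tensor with ⟨v, w, hv, hw, rfl⟩ | ⟨v, w, hv, hw, rfl⟩
    · obtain rfl := IsErasure.unit_iff.1 hw
      simpa using hv
    · exact hw.elim
  | c A B =>
    rcases hu.cases_tensor with ⟨v, w, hv, hw, rfl⟩ | ⟨v, w, hv, hw, rfl⟩
    · rw [← BraidedCategory.braiding_naturality_assoc, braiding_rightUnitor]
      exact tensor_right hw hv
    · rw [← BraidedCategory.braiding_naturality_assoc, braiding_leftUnitor]
      exact hw.tensor_left hv
  | psi A B =>
    obtain ⟨v, hv, rfl⟩ := hu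
    rw [psi_eps_assoc]
    rcases hv.cases_tensor with ⟨v₁, v₂, h₁, h₂, rfl⟩ | ⟨v₁, v₂, h₁, h₂, rfl⟩
    · rw [tensorHom_comp_tensorHom_assoc]
      exact h₁.eps_comp.tensor_left h₂.eps_comp
    · rw [tensorHom_comp_tensorHom_assoc]
      exact tensor_right h₁.eps_comp h₂.eps_comp
  | psi0 =>
    obtain ⟨v, hv, rfl⟩ := hu
    rw [psi0_eps_assoc]
    exact hv
  | eps A => exact hu.eps_comp
  | delta A =>
    obtain ⟨v, hv, rfl⟩ := hu
    rw [delta_eps_assoc]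
    exact hv

end IsPoint

/-! ### Pulling selections back along arrows. -/

theorem Sel.exists_eq_tensor {A B : Obj X} (S : Sel (A ⊗ B)) : ∃ S₁ S₂, S = .tensor S₁ S₂ :=
  match S with
  | .tensor S₁ S₂ => ⟨S₁, S₂, rfl⟩

theorem Sel.eq_unit (S : Sel (𝟙_ (Obj X))) : S = .unit :=
  match S with
  | .unit => rfl

/-- Splittings commute with regrouping because the interchange is compatible with associativity; the
unitors and the braiding are handled by the analogous compatibilities. -/
theorem Sel.split_associator {A B C : Obj X} (S : Sel A) (T : Sel B) (U : Sel C) :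
    (α_ A B C).hom ≫ (tensor S (tensor T U)).split =
      (tensor (tensor S T) U).split ≫ ((α_ _ _ _).hom ⊗ₘ (α_ _ _ _).hom) := by
  have h := tensor_associativity S.taken S.left T.taken T.left U.taken U.left
  calc
    _ = (α_ A B C).hom ≫ (S.split ⊗ₘ (T.split ⊗ₘ U.split) ≫ tensorμ _ _ _ _) ≫
        tensorμ _ _ _ _ := rfl
    _ = ((S.split ⊗ₘ T.split) ⊗ₘ U.split) ≫ (α_ _ _ _).hom ≫
        (_ ◁ tensorμ _ _ _ _) ≫ tensorμ _ _ _ _ := by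
      rw [associator_naturality_assoc, ← id_tensorHom, tensorHom_comp_tensorHom_assoc,
        Category.comp_id]
    _ = (((S.split ⊗ₘ T.split) ≫ tensorμ _ _ _ _ ⊗ₘ U.split) ≫ tensorμ _ _ _ _) ≫
        ((α_ _ _ _).hom ⊗ₘ (α_ _ _ _).hom) := by
      rw [← h, ← tensorHom_id, tensorHom_comp_tensorHom_assoc, Category.comp_id, Category.assoc]

theorem Sel.split_leftUnitor {A : Obj X} (S : Sel A) :
    (λ_ A).hom ≫ S.split = (tensor unit S).split ≫ ((λ_ _).hom ⊗ₘ (λ_ _).hom) := by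
  calc
    _ = (𝟙 _ ⊗ₘ S.split) ≫ (λ_ _).hom := by rw [id_tensorHom, leftUnitor_naturality]
    _ = (((λ_ (𝟙_ (Obj X))).inv ⊗ₘ S.split) ≫ tensorμ _ _ _ _) ≫
        ((λ_ _).hom ⊗ₘ (λ_ _).hom) := by
      rw [tensor_left_unitality, ← tensorHom_id, tensorHom_comp_tensorHom_assoc,
        Category.comp_id, Category.id_comp, Category.assoc]

theorem Sel.split_rightUnitor {A : Obj X} (S : Sel A) :
    (ρ_ A).hom ≫ S.split = (tensor S unit).split ≫ ((ρ_ _).hom ⊗ₘ (ρ_ _).hom) := by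
  calc
    _ = (S.split ⊗ₘ 𝟙 _) ≫ (ρ_ _).hom := by rw [tensorHom_id, rightUnitor_naturality]
    _ = ((S.split ⊗ₘ (λ_ (𝟙_ (Obj X))).inv) ≫ tensorμ _ _ _ _) ≫
        ((ρ_ _).hom ⊗ₘ (ρ_ _).hom) := by
      rw [tensor_right_unitality, ← id_tensorHom, tensorHom_comp_tensorHom_assoc,
        Category.comp_id, Category.id_comp, Category.assoc]

theorem Sel.split_braiding {A B : Obj X} (S : Sel A) (T : Sel B) :
    (β_ A B).hom ≫ (tensor T S).split =
      (tensor S T).split ≫ ((β_ _ _).hom ⊗ₘ (β_ _ _).hom) := by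
  calc
    _ = (β_ A B).hom ≫ (T.split ⊗ₘ S.split) ≫ tensorμ _ _ _ _ := rfl
    _ = ((S.split ⊗ₘ T.split) ≫ tensorμ _ _ _ _) ≫ ((β_ _ _).hom ⊗ₘ (β_ _ _).hom) := by
      rw [← BraidedCategory.braiding_naturality_assoc, SymmetricCategory.braiding_tensorμ,
        Category.assoc]

theorem Sel.tensorHom_split {A B A' B' : Obj X} {f : A ⟶ B} {g : A' ⟶ B'} {S : Sel A}
    {S' : Sel A'} {T : Sel B} {T' : Sel B'} {f₁ : S.taken ⟶ T.taken} {f₂ : S.left ⟶ T.left}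
    {g₁ : S'.taken ⟶ T'.taken} {g₂ : S'.left ⟶ T'.left}
    (hf : f ≫ T.split = S.split ≫ (f₁ ⊗ₘ f₂)) (hg : g ≫ T'.split = S'.split ≫ (g₁ ⊗ₘ g₂)) :
    (f ⊗ₘ g) ≫ (tensor T T').split =
      (tensor S S').split ≫ ((f₁ ⊗ₘ g₁) ⊗ₘ (f₂ ⊗ₘ g₂)) := by
  calc
    _ = (f ⊗ₘ g) ≫ (T.split ⊗ₘ T'.split) ≫ tensorμ _ _ _ _ := rfl
    _ = ((S.split ⊗ₘ S'.split) ≫ tensorμ _ _ _ _) ≫ ((f₁ ⊗ₘ g₁) ⊗ₘ (f₂ ⊗ₘ g₂)) := by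
      rw [tensorHom_comp_tensorHom_assoc, hf, hg, Category.assoc, ← tensorμ_natural,
        tensorHom_comp_tensorHom_assoc]

/-- Selections can be pulled back along the arrow: what is taken comes from what is taken, what is
left from what is left, and the pulled back selection is determined by the links. -/
def PullsBack {A B : Obj X} (f : A ⟶ B) : Prop :=
  ∀ T : Sel B, ∃ (S : Sel A) (f₁ : S.taken ⟶ T.taken) (f₂ : S.left ⟶ T.left),
    IsCoalgHom f₁ ∧ f ≫ T.split = S.split ≫ (f₁ ⊗ₘ f₂) ∧
      ∀ b o, S.Marked b o ↔ ∃ o', homLink f o o' ∧ T.Marked b o'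

namespace PullsBack

variable {A B C D : Obj X}

theorem id (A : Obj X) : PullsBack (𝟙 A) := fun T =>
  ⟨T, 𝟙 _, 𝟙 _, .id _, by simp, fun _ _ =>
    ⟨fun h => ⟨_, rfl, h⟩, by rintro ⟨_, rfl, h⟩; exact h⟩⟩

theorem comp {f : A ⟶ B} {g : B ⟶ C} (hf : PullsBack f) (hg : PullsBack g) :
    PullsBack (f ≫ g) := fun U => by
  obtain ⟨T, g₁, g₂, hg₁, eg, mg⟩ := hg U
  obtain ⟨S, f₁, f₂, hf₁, ef, mf⟩ := hf T
  refine ⟨S, f₁ ≫ g₁, f₂ ≫ g₂, hf₁.comp hg₁, ?_, fun b o => ?_⟩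
  · rw [Category.assoc, eg, reassoc_of% ef, tensorHom_comp_tensorHom]
  · simp only [mf, mg, homLink_comp]
    grind

theorem tensor {f : A ⟶ B} {g : C ⟶ D} (hf : PullsBack f) (hg : PullsBack g) :
    PullsBack (f ⊗ₘ g) := fun T => by
  obtain ⟨T, T', rfl⟩ := T.exists_eq_tensor
  obtain ⟨S, f₁, f₂, hf₁, ef, mf⟩ := hf T
  obtain ⟨S', g₁, g₂, hg₁, eg, mg⟩ := hg T'
  refine ⟨.tensor S S', f₁ ⊗ₘ g₁, f₂ ⊗ₘ g₂, hf₁.tensor hg₁, Sel.tensorHom_split ef eg, ?_⟩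
  rw [homLink_tensor]
  rintro b (o | o)
  · refine (mf b o).trans ⟨fun ⟨o', h, h'⟩ => ⟨.inl o', .inl h, h'⟩, ?_⟩
    rintro ⟨_, h | _, h'⟩
    exact ⟨_, h, h'⟩
  · refine (mg b o).trans ⟨fun ⟨o', h, h'⟩ => ⟨.inr o', .inr h, h'⟩, ?_⟩
    rintro ⟨_, _ | h, h'⟩
    exact ⟨_, h, h'⟩

/-- An unopened box stays unopened, and `L f` itself becomes a component. An opened box passes `f`
inside by naturality of `ε`, and its selection is pulled back along `f`. -/
theorem boxMap {f : A ⟶ B} (hf : PullsBack f) : PullsBack (boxMap f) := fun T => by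
  cases T with
  | whole _ c =>
    cases c
    · refine ⟨.whole A false, 𝟙 _, MonoidalComonad.boxMap f, .id _, ?_, ?_⟩
      · exact comp_leftUnitor_inv _
      · rw [homLink_boxMap]
        rintro b (_ | o)
        · exact ⟨fun h => ⟨none, .none, h⟩, by rintro ⟨_, _ | _, h⟩; exact h⟩
        · exact ⟨False.elim, by rintro ⟨_, _ | _, h⟩; exact h⟩
    · refine ⟨.whole A true, MonoidalComonad.boxMap f, 𝟙 _, .boxMap f, ?_, ?_⟩
      · exact comp_rightUnitor_inv _
      · rw [homLink_boxMap]
        rintro b (_ | o)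
        · exact ⟨fun h => ⟨none, .none, h⟩, by rintro ⟨_, _ | _, h⟩; exact h⟩
        · exact ⟨False.elim, by rintro ⟨_, _ | _, h⟩; exact h⟩
  | opened T =>
    obtain ⟨S, f₁, f₂, hf₁, ef, mf⟩ := hf T
    refine ⟨.opened S, f₁, f₂, hf₁, ?_, ?_⟩
    · calc
        _ = MonoidalComonad.boxMap f ≫ MonoidalComonad.eps _ ≫ T.split := rfl
        _ = (MonoidalComonad.eps _ ≫ S.split) ≫ (f₁ ⊗ₘ f₂) := by
          rw [eps_natural_assoc, ef, Category.assoc]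
    · rw [homLink_boxMap]
      rintro b (_ | o)
      · exact ⟨False.elim, by rintro ⟨_, _ | _, h⟩; exact h⟩
      · refine (mf b o).trans ⟨fun ⟨o', h, h'⟩ => ⟨some o', .some h, h'⟩, ?_⟩
        rintro ⟨_, hr, h'⟩
        cases hr with | some h => exact ⟨_, h, h'⟩

theorem associator_hom (A B C : Obj X) : PullsBack (α_ A B C).hom := fun T => by
  obtain ⟨T₁, T, rfl⟩ := T.exists_eq_tensor
  obtain ⟨T₂, T₃, rfl⟩ := T.exists_eq_tensor
  refine ⟨.tensor (.tensor T₁ T₂) T₃, (α_ _ _ _).hom, (α_ _ _ _).hom, .associator_hom _ _ _,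
    Sel.split_associator _ _ _, ?_⟩
  rintro b ((o | o) | o) <;>
    exact ⟨fun h => ⟨_, rfl, h⟩, by rintro ⟨_, rfl, h⟩; exact h⟩

theorem associator_inv (A B C : Obj X) : PullsBack (α_ A B C).inv := fun T => by
  obtain ⟨T, T₃, rfl⟩ := T.exists_eq_tensor
  obtain ⟨T₁, T₂, rfl⟩ := Sel.exists_eq_tensor T
  refine ⟨.tensor T₁ (.tensor T₂ T₃), (α_ _ _ _).inv, (α_ _ _ _).inv, .associator_inv _ _ _,
    ?_, fun b o => ⟨?_, ?_⟩⟩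
  · exact inv_comp_eq_comp_tensorHom_inv (Sel.split_associator ..)
  · rcases o with o | o | o
    · exact fun h => ⟨.inl (.inl o), rfl, h⟩
    · exact fun h => ⟨.inl (.inr o), rfl, h⟩
    · exact fun h => ⟨.inr o, rfl, h⟩
  · rintro ⟨(o | o) | o, rfl, h⟩ <;> exact h

theorem leftUnitor_hom (A : Obj X) : PullsBack (λ_ A).hom := fun T => by
  refine ⟨.tensor .unit T, (λ_ _).hom, (λ_ _).hom, .leftUnitor_hom _, Sel.split_leftUnitor _, ?_⟩
  rintro b (o | o)
  · exact o.elim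
  · exact ⟨fun h => ⟨o, rfl, h⟩, by rintro ⟨_, h, h'⟩; cases h; exact h'⟩

theorem leftUnitor_inv (A : Obj X) : PullsBack (λ_ A).inv := fun T => by
  obtain ⟨T', T, rfl⟩ := T.exists_eq_tensor
  obtain rfl := T'.eq_unit
  refine ⟨T, (λ_ _).inv, (λ_ _).inv, .leftUnitor_inv _, ?_, fun b o => ?_⟩
  · exact inv_comp_eq_comp_tensorHom_inv (Sel.split_leftUnitor ..)
  · exact ⟨fun h => ⟨_, rfl, h⟩, by rintro ⟨_, rfl, h⟩; exact h⟩

theorem rightUnitor_hom (A : Obj X) : PullsBack (ρ_ A).hom := fun T => by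
  refine ⟨.tensor T .unit, (ρ_ _).hom, (ρ_ _).hom, .rightUnitor_hom _,
    Sel.split_rightUnitor _, ?_⟩
  rintro b (o | o)
  · exact ⟨fun h => ⟨o, rfl, h⟩, by rintro ⟨_, h, h'⟩; cases h; exact h'⟩
  · exact o.elim

theorem rightUnitor_inv (A : Obj X) : PullsBack (ρ_ A).inv := fun T => by
  obtain ⟨T, T', rfl⟩ := T.exists_eq_tensor
  obtain rfl := T'.eq_unit
  refine ⟨T, (ρ_ _).inv, (ρ_ _).inv, .rightUnitor_inv _, ?_, fun b o => ?_⟩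
  · exact inv_comp_eq_comp_tensorHom_inv (Sel.split_rightUnitor ..)
  · exact ⟨fun h => ⟨_, rfl, h⟩, by rintro ⟨_, rfl, h⟩; exact h⟩

theorem braiding (A B : Obj X) : PullsBack (β_ A B).hom := fun T => by
  obtain ⟨T, S, rfl⟩ := T.exists_eq_tensor
  refine ⟨.tensor S T, (β_ _ _).hom, (β_ _ _).hom, .braiding _ _, Sel.split_braiding _ _, ?_⟩
  rintro b (o | o) <;>
    exact ⟨fun h => ⟨_, rfl, h⟩, by rintro ⟨_, rfl, h⟩; exact h⟩

/-- The arrow `ε` is absorbed by the splitting, which opens one more box. It need not be a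
homomorphism of coalgebras, so it must not end up in a component. -/
theorem eps (A : Obj X) : PullsBack (eps A) := fun T => by
  refine ⟨.opened T, 𝟙 _, 𝟙 _, .id _, ?_, ?_⟩
  · exact eq_comp_id_tensorHom_id rfl
  · rintro b (_ | o)
    · exact ⟨False.elim, fun ⟨_, h, _⟩ => nomatch h⟩
    · exact ⟨fun h => ⟨o, rfl, h⟩, by rintro ⟨_, h, h'⟩; cases h; exact h'⟩

theorem delta (A : Obj X) : PullsBack (delta A) := fun T => by
  cases T with
  | whole _ c =>
    cases c
    · refine ⟨.whole A false, 𝟙 _, MonoidalComonad.delta A, .id _, ?_, ?_⟩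
      · exact comp_leftUnitor_inv _
      · rintro b (_ | o)
        · exact ⟨fun h => ⟨none, rfl, h⟩, by rintro ⟨_ | _, _, h⟩; exacts [h, h.elim]⟩
        · exact ⟨False.elim, by rintro ⟨_ | _, h, h'⟩ <;> first | exact h' | cases h⟩
    · refine ⟨.whole A true, MonoidalComonad.delta A, 𝟙 _, .delta A, ?_, ?_⟩
      · exact comp_rightUnitor_inv _
      · rintro b (_ | o)
        · exact ⟨fun h => ⟨none, rfl, h⟩, by rintro ⟨_ | _, _, h⟩; exacts [h, h.elim]⟩
        · exact ⟨False.elim, by rintro ⟨_ | _, h, h'⟩ <;> first | exact h' | cases h⟩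
  | opened T =>
    -- Opening the outer box of `L L A` undoes `δ` by the counit law, so `T`, a selection in `L A`,
    -- is itself the pullback.
    refine ⟨T, 𝟙 _, 𝟙 _, .id _, ?_, fun b o => ⟨fun h => ⟨some o, rfl, h⟩, ?_⟩⟩
    · exact eq_comp_id_tensorHom_id (delta_eps_assoc _ _)
    · rintro ⟨_ | _, h, h'⟩
      · exact h'.elim
      · exact (show o = _ from h) ▸ h'

theorem psi (A B : Obj X) : PullsBack (psi A B) := fun T => by
  cases T with
  | whole _ c =>
    cases c
    · refine ⟨.tensor (.whole A false) (.whole B false), (λ_ _).hom, MonoidalComonad.psi A B,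
        .leftUnitor_hom _, ?_, ?_⟩
      · exact comp_leftUnitor_inv_tensorμ _
      · rintro b ((_ | o) | (_ | o)) <;>
          exact ⟨fun h => ⟨_, rfl, h⟩, by rintro ⟨_, rfl, h⟩; exact h⟩
    · refine ⟨.tensor (.whole A true) (.whole B true), MonoidalComonad.psi A B, (λ_ _).hom,
        .psi A B, ?_, ?_⟩
      · exact comp_rightUnitor_inv_tensorμ _
      · rintro b ((_ | o) | (_ | o)) <;>
          exact ⟨fun h => ⟨_, rfl, h⟩, by rintro ⟨_, rfl, h⟩; exact h⟩
  | opened T =>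
    obtain ⟨T₁, T₂, rfl⟩ := Sel.exists_eq_tensor T
    refine ⟨.tensor (.opened T₁) (.opened T₂), 𝟙 _, 𝟙 _, .id _, ?_, ?_⟩
    · refine eq_comp_id_tensorHom_id (P := T₁.taken ⊗ T₂.taken) (Q := T₁.left ⊗ T₂.left) ?_
      calc
        _ = MonoidalComonad.psi A B ≫ MonoidalComonad.eps _ ≫ (T₁.split ⊗ₘ T₂.split) ≫
            tensorμ _ _ _ _ := rfl
        _ = (MonoidalComonad.eps A ≫ T₁.split ⊗ₘ MonoidalComonad.eps B ≫ T₂.split) ≫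
            tensorμ _ _ _ _ := by rw [psi_eps_assoc, tensorHom_comp_tensorHom_assoc]
    · rintro b ((_ | o) | (_ | o)) <;>
          exact ⟨fun h => ⟨_, rfl, h⟩, by rintro ⟨_, rfl, h⟩; exact h⟩

theorem psi0 : PullsBack (psi0 (X := X)) := fun T => by
  cases T with
  | whole _ c =>
    cases c
    · refine ⟨.unit, 𝟙 _, MonoidalComonad.psi0, .id _, ?_, nofun⟩
      exact comp_leftUnitor_inv _
    · refine ⟨.unit, MonoidalComonad.psi0, 𝟙 _, .psi0, ?_, nofun⟩
      -- The unit is split by the left unitor, a taken box by the right one; the two agree at `I`.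
      exact (comp_rightUnitor_inv _).trans (by rw [← unitors_inv_equal]; rfl)
  | opened T =>
    obtain rfl := Sel.eq_unit T
    refine ⟨.unit, 𝟙 _, 𝟙 _, .id _, ?_, nofun⟩
    exact eq_comp_id_tensorHom_id (psi0_eps_assoc _)

end PullsBack

theorem pullsBack {A B : Obj X} (f : A ⟶ B) : PullsBack f :=
  hom_induction .id (fun _ _ => .comp) (fun _ _ => .tensor) (fun _ => .boxMap) .associator_hom
    .associator_inv .leftUnitor_hom .leftUnitor_inv .rightUnitor_hom .rightUnitor_inv .braiding
    .psi .psi0 .eps .delta f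

/-! ### The induction on the target. -/

/-- Arrows with the formula as target are determined by their links. -/
def LinksDetermine (B : Obj X) : Prop :=
  ∀ ⦃A : Obj X⦄ (f g : A ⟶ B), homLink f = homLink g → f = g

namespace LinksDetermine

theorem of_iso {A B : Obj X} (h : LinksDetermine A) (i : B ≅ A) : LinksDetermine B :=
  fun _ _ _ e => (cancel_mono i.hom).1 (h _ _ (homLink_comp_congr e rfl))

theorem unit : LinksDetermine (𝟙_ (Obj X)) := fun _ f g _ => by
  have := (IsErasure.unit.comp f).unique (IsErasure.unit.comp g)
  simpa using this

theorem letter (x : X) : LinksDetermine (Obj.letter x) := fun _ f g _ => by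
  have h : IsPoint x (Obj.letter x) (𝟙 _) := ⟨rfl, rfl⟩
  simpa using (h.comp f).unique (h.comp g)

/-- Arrows with the same links have splittings with the same source selection and with components
that have the same links. -/
theorem exists_split {A B : Obj X} {f g : A ⟶ B} (h : homLink f = homLink g) (T : Sel B) :
    ∃ (S : Sel A) (f₁ g₁ : S.taken ⟶ T.taken) (f₂ g₂ : S.left ⟶ T.left),
      IsCoalgHom f₁ ∧ IsCoalgHom g₁ ∧ homLink f₁ = homLink g₁ ∧ homLink f₂ = homLink g₂ ∧
        f ≫ T.split = S.split ≫ (f₁ ⊗ₘ f₂) ∧ g ≫ T.split = S.split ≫ (g₁ ⊗ₘ g₂) := by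
  obtain ⟨S, f₁, f₂, hf₁, ef, mf⟩ := pullsBack f T
  obtain ⟨S', g₁, g₂, hg₁, eg, mg⟩ := pullsBack g T
  -- Both pullbacks have the marks dictated by the common links.
  obtain rfl : S = S' := S.eq_of_marked S' fun b o => by rw [mf, mg, h]
  have e : homLink (f₁ ⊗ₘ f₂) = homLink (g₁ ⊗ₘ g₂) := by
    apply (Separating.split S).homLink_cancel
    rw [← ef, ← eg]
    exact homLink_comp_congr h rfl
  obtain ⟨e₁, e₂⟩ := homLink_tensor_inj e
  exact ⟨S, f₁, g₁, f₂, g₂, hf₁, hg₁, e₁, e₂, ef, eg⟩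

theorem tensor {A B : Obj X} (hA : LinksDetermine A) (hB : LinksDetermine B) :
    LinksDetermine (A ⊗ B) := fun _ f g h => by
  have : IsIso (Sel.tensor (.full true A) (.full false B)).split := by
    have := Sel.isIso_split_full true A
    have := Sel.isIso_split_full false B
    have : IsIso (tensorμ (Sel.full true A).taken (Sel.full true A).left (Sel.full false B).taken
        (Sel.full false B).left) := ⟨_, tensorμ_tensorδ _ _ _ _, tensorδ_tensorμ _ _ _ _⟩
    exact inferInstanceAs (IsIso ((_ ⊗ₘ _) ≫ tensorμ _ _ _ _))
  obtain ⟨S, f₁, g₁, f₂, g₂, -, -, h₁, h₂, ef, eg⟩ :=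
    exists_split h (Sel.tensor (.full true A) (.full false B))
  obtain ⟨i⟩ := Sel.taken_full_false B
  obtain ⟨j⟩ := Sel.left_full_true A
  have hf₁ : f₁ = g₁ := hA.of_iso ((eqToIso (Sel.taken_full_true A) ⊗ᵢ i) ≪≫ ρ_ A) f₁ g₁ h₁
  have hf₂ : f₂ = g₂ := hB.of_iso ((j ⊗ᵢ eqToIso (Sel.left_full_false B)) ≪≫ λ_ B) f₂ g₂ h₂
  refine (cancel_mono (Sel.tensor (.full true A) (.full false B)).split).1 ?_
  rw [ef, eg, hf₁, hf₂]

/-- Composing with `ε` at once would lose information: `ε` at `L A` and `L` of `ε` at `A` have the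
same composite with `ε`, but different links. Splitting first moves the opening of source boxes into
`S`; what remains is a homomorphism, for which the composite with `ε` suffices. -/
theorem box {A : Obj X} (hA : LinksDetermine A) : LinksDetermine A.box := fun _ f g h => by
  have := Sel.isIso_split_full true A.box
  obtain ⟨S, f₁, g₁, f₂, g₂, hf₁, hg₁, h₁, h₂, ef, eg⟩ := exists_split h (Sel.full true A.box)
  have e₁ : f₁ = g₁ := hf₁.ext hg₁ (hA _ _ (homLink_comp_congr h₁ rfl))
  have e₂ : f₂ = g₂ := unit _ _ h₂
  refine (cancel_mono (Sel.full true A.box).split).1 ?_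
  rw [ef, eg, e₁, e₂]

end LinksDetermine

theorem linksDetermine (B : Obj X) : LinksDetermine B := by
  induction B with
  | letter x => exact .letter x
  | unit => exact .unit
  | tensor A B hA hB => exact hA.tensor hB
  | box A hA => exact hA.box

theorem homLink_eq_of_map_eq {A B : Obj X} {f g : A ⟶ B} (h : (G X).map f = (G X).map g) :
    homLink f = homLink g := by
  induction f using Quotient.ind with | _ f
  induction g using Quotient.ind with | _ g
  ext x y
  have := Set.ext_iff.1 (show graph f = graph g from h) (number A x, number B y)
  simp only [graph, Set.mem_ofPred_eq, Equiv.symm_apply_apply] at this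
  exact this

end MonoidalComonad

theorem mainTheorem4 (X : Type u) : (MonoidalComonad.G X).Faithful :=
  ⟨fun h => MonoidalComonad.linksDetermine _ _ _ (MonoidalComonad.homLink_eq_of_map_eq h)⟩
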